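/- \textbf{Vines.} An R-vine on a finite set $V_1$ with $n$ elements is a sequence of trees $\mathcal V=(V_k,E_k)_{k=1}^{n-1}$ such that $V_k=E_{k-1}$ for $k\ge 2$ and, whenever $a,b\in V_k$ $(k\ge2)$ are joined by an edge of $E_k$, the edges $a,b\in E_{k-1}$ satisfy $|a\cap b|=1$. The complete union $\mathcal U_e\subseteq V_1$ of an edge $e$ is the set of elements of $V_1$ used in its iterated construction (and $\mathcal U_i=\{i\}$ for $i\in V_1$). An edge $e=\{v,w\}$ has conditioning set $D_e=\mathcal U_v\cap\mathcal U_w$ and conditioned elements $a_e,b_e$ given by $\{a_e\}=\mathcal U_v\setminus D_e$, $\{b_e\}=\mathcal U_w\setminus D_e$; its label is $(a_e,b_e\mid D_e)$. \textbf{Stationary vines.} Let $V_1=\{1,\dots,T\}\times\{1,\dots,d\}$. For $1\le t\le t+m\le T$ the restriction $\mathcal V_{t,t+m}=(V_k',E_k')_k$ is defined by $V_1'=\{t,\dots,t+m\}\times\{1,\dots,d\}$, $E_k'=E_k\cap\binom{V_k'}{2}$, $V_{k+1}'=E_k'$. The vine $\mathcal V$ is stationary if there are vines $\mathcal V^{(m)}$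 on $\{1,\dots,m+1\}\times\{1,\dots,d\}$, $m=0,\dots,T-1$, such that for all $m$ and all $1\le t\le T-m$ the restriction $\mathcal V_{t,t+m}$ is a vine and is a translation of $\mathcal V^{(m)}$, i.e. in every tree the labels of the edges of $\mathcal V_{t,t+m}$ are exactly those of $\mathcal V^{(m)}$ with all time indices shifted by $t-1$. \textbf{Vine copula models.} Let $\mathcal C(\mathcal V)$ assign to every edge $e$ of $\mathcal V$ the density $c_e$ of a bivariate copula. A random vector $(\boldsymbol U_1,\dots,\boldsymbol U_T)$ with components $U_{t,j}$, uniformly distributed on $[0,1]$, follows the (simplified) vine copula model $(\mathcal V,\mathcal C(\mathcal V))$ if for every edge $e$ the conditional copula of $(U_{a_e},U_{b_e})$ given $\boldsymbol U_{D_e}$ has density $c_e$: writing $C_{a\mid D}(\cdot\mid \boldsymbol u_D)$ for the conditional distribution function of $U_a$ given $\boldsymbol U_D=\boldsymbol u_D$, the pair $\bigl(C_{a_e\mid D_e}(U_{a_e}\mid\boldsymbol U_{D_e}),\,C_{b_e\mid D_e}(U_{b_e}\mid\boldsymbol U_{D_e})\bigr)$ is independent of $\boldsymbol U_{D_e}$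 and has density $c_e$ on $[0,1]^2$. \textbf{Markov property.} The series $\boldsymbol U_1,\dots,\boldsymbol U_T$ is Markov of order $p$ if for all $p<t\le T$ and $\boldsymbol u\in\mathbb R^d$, almost surely, $$\Pr(\boldsymbol U_t\le\boldsymbol u\mid\boldsymbol U_{t-1},\dots,\boldsymbol U_1)=\Pr(\boldsymbol U_t\le\boldsymbol u\mid\boldsymbol U_{t-1},\dots,\boldsymbol U_{t-p}).$$ \textbf{Theorem.} Let $0\le p<T$, let $\mathcal V$ be a stationary vine on $\{1,\dots,T\}\times\{1,\dots,d\}$, and let $(\boldsymbol U_1,\dots,\boldsymbol U_T)$ follow the vine copula model $(\mathcal V,\mathcal C(\mathcal V))$. Then $\boldsymbol U_1,\dots,\boldsymbol U_T$ is Markov of order $p$ if and only if $c_e=1$ almost everywhere on $[0,1]^2$ (that is, $c_e$ is the density of the independence copula) for every edge $e$ of $\mathcal V$ that belongs to none of the restrictions $\mathcal V_{t,t+p}$, $t=1,\dots,T-p$. -/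

import Mathlib

open MeasureTheory ProbabilityTheory Set
open scoped ENNReal NNReal

/-! ### Regular vines -/

/-- Iterated unordered pairs: a vertex of the `(k+1)`-st tree of a vine. The vertices of the first
tree are elements of `ι`; a vertex of a later tree is an edge of the preceding tree. -/
def VineNode (ι : Type) : ℕ → Type
  | 0 => ι
  | k + 1 => Sym2 (VineNode ι k)

/-- A sequence of nested graphs over the vertex set `S`. The level `k` here is the `(k+1)`-st graph
of the sequence, and `E k` is its set of edges. -/
structure GraphSeq (ι : Type) where
  S : Finset ι
  E : ∀ k : ℕ, Set (Sym2 (VineNode ι k))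

namespace GraphSeq

variable {ι : Type}

/-- The vertices at each level: `S` at the first level, then the edges of the preceding graph. -/
def V (G : GraphSeq ι) : ∀ k : ℕ, Set (VineNode ι k)
  | 0 => {i : ι | i ∈ G.S}
  | k + 1 => G.E k

/-- The graph at level `k`. -/
def graph (G : GraphSeq ι) (k : ℕ) : SimpleGraph (G.V k) :=
  (SimpleGraph.fromEdgeSet (G.E k)).induce (G.V k)

/-- `G` is a regular vine on its vertex set `S`, `n = |S|`: there are `n - 1` graphs in the
sequence (so no edges beyond), each is a tree on its vertices, and the proximity condition holds. -/
structure IsVine (G : GraphSeq ι) : Prop where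
  edge_mem : ∀ k, ∀ e ∈ G.E k, ¬ e.IsDiag ∧ ∀ v ∈ e, v ∈ G.V k
  empty : ∀ k, G.S.card ≤ k + 1 → G.E k = ∅
  tree : ∀ k, k + 1 < G.S.card → (G.graph k).IsTree
  proximity : ∀ k, ∀ v w : Sym2 (VineNode ι k),
    (s(v, w) : Sym2 (VineNode ι (k + 1))) ∈ G.E (k + 1) → ∃! x, x ∈ v ∧ x ∈ w

end GraphSeq

/-- The complete union of a vertex: all elements of `ι` used in its iterated construction. -/
def completeUnion {ι : Type} [DecidableEq ι] : ∀ k : ℕ, VineNode ι k → Finset ι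
  | 0, i => {(i : ι)}
  | k + 1, e => Sym2.lift ⟨fun v w => completeUnion k v ∪ completeUnion k w,
      fun _ _ => Finset.union_comm _ _⟩ e

/-- The conditioning set `D_e` of an edge `e` at level `k`. -/
def condSet {ι : Type} [DecidableEq ι] (k : ℕ) (e : Sym2 (VineNode ι k)) : Finset ι :=
  Sym2.lift ⟨fun v w => completeUnion k v ∩ completeUnion k w,
    fun _ _ => Finset.inter_comm _ _⟩ e

/-- `(a, b)` is the conditioned set of the edge `e` (in one of its two orders): `e` connects `v`
and `w`, where `a` is the only element of the complete union of `v` outside of the conditioning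
set, and `b` is the only such element for `w`. The label of `e` is then `(a, b | condSet k e)`. -/
def IsConditioned {ι : Type} [DecidableEq ι] (k : ℕ) (e : Sym2 (VineNode ι k)) (a b : ι) : Prop :=
  ∃ v w : VineNode ι k, e = s(v, w) ∧
    completeUnion k v \ condSet k e = {a} ∧ completeUnion k w \ condSet k e = {b}

/-! ### Vines for time series

The vertices of the first tree are pairs `(t, j)` of a time index and a variable index. -/

/-- The vertices `{s, …, t} × {1, …, d}`. -/
noncomputable def timeBlock (d : ℕ) (s t : ℤ) : Finset (ℤ × Fin d) :=
  Finset.Icc s t ×ˢ Finset.univ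

/-- Shift in time by `τ` steps. -/
def timeShift {d : ℕ} (τ : ℤ) (i : ℤ × Fin d) : ℤ × Fin d := (i.1 + τ, i.2)

/-- `e = e' + (τ, 0)`: the label of `e` is the label of `e'`, shifted in time by `τ`. -/
def IsEdgeShift {d : ℕ} (τ : ℤ) (k : ℕ) (e e' : Sym2 (VineNode (ℤ × Fin d) k)) : Prop :=
  (∃ a b, IsConditioned k e' a b ∧ IsConditioned k e (timeShift τ a) (timeShift τ b)) ∧
    condSet k e = (condSet k e').image (timeShift τ)

namespace GraphSeq

/-- The vertices of the restriction to a subset `S'` of the first vertex set: `S'` itself at the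
first level, then those edges of the preceding graph that connect two retained vertices. -/
def restrictV {ι : Type} (G : GraphSeq ι) (S' : Finset ι) : ∀ k : ℕ, Set (VineNode ι k)
  | 0 => {i : ι | i ∈ S'}
  | k + 1 => {e : Sym2 (VineNode ι k) | e ∈ G.E k ∧ ∀ v ∈ e, v ∈ G.restrictV S' k}

/-- The restriction `𝒱_{s,t}` of a graph sequence to the time points `s, …, t`. -/
noncomputable def restrict {d : ℕ} (G : GraphSeq (ℤ × Fin d)) (s t : ℤ) : GraphSeq (ℤ × Fin d) where
  S := timeBlock d s t
  E k := {e | e ∈ G.E k ∧ ∀ v ∈ e, v ∈ G.restrictV (timeBlock d s t) k}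

/-- `G` and `H` are vines and `G` is the translation of `H` by `τ` time steps. -/
def IsTranslation {d : ℕ} (τ : ℤ) (G H : GraphSeq (ℤ × Fin d)) : Prop :=
  G.IsVine ∧ H.IsVine ∧
    ∀ k, (∀ e ∈ G.E k, ∃ e' ∈ H.E k, IsEdgeShift τ k e e') ∧
      (∀ e' ∈ H.E k, ∃ e ∈ G.E k, IsEdgeShift τ k e e')

/-- `G` is a stationary vine on `{1, …, T} × {1, …, d}`. -/
def IsStationaryVine {d : ℕ} (T : ℕ) (G : GraphSeq (ℤ × Fin d)) : Prop :=
  G.S = timeBlock d 1 T ∧ G.IsVine ∧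
    ∃ W : ℕ → GraphSeq (ℤ × Fin d), ∀ m : ℕ, m < T →
      (W m).S = timeBlock d 1 (m + 1) ∧ (W m).IsVine ∧
        ∀ t : ℤ, 1 ≤ t → t + m ≤ T → IsTranslation (t - 1) (G.restrict t (t + m)) (W m)

end GraphSeq

/-! ### Pair-copulas and vine copula models -/

/-- The uniform distribution on `[0, 1]`. -/
noncomputable def stdUniform : Measure ℝ := volume.restrict (Icc 0 1)

/-- The measure on `[0, 1]²` with Lebesgue density `c`. -/
noncomputable def pairMeasure (c : ℝ × ℝ → ℝ≥0) : Measure (ℝ × ℝ) :=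
  (volume.restrict (Icc 0 1 ×ˢ Icc 0 1)).withDensity (fun x => (c x : ℝ≥0∞))

/-- `c` is the density of a bivariate copula: a distribution on `[0, 1]²` with uniform margins. -/
structure IsCopulaDensity (c : ℝ × ℝ → ℝ≥0) : Prop where
  measurable : Measurable c
  fst : (pairMeasure c).map Prod.fst = stdUniform
  snd : (pairMeasure c).map Prod.snd = stdUniform

/-- `c ≡ 1` as a density on `[0, 1]²`: the independence copula. -/
def IsIndepCopula (c : ℝ × ℝ → ℝ≥0) : Prop :=
  ∀ᵐ x ∂(volume.restrict (Icc (0 : ℝ) 1 ×ˢ Icc (0 : ℝ) 1)), c x = 1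

/-- A set `𝒞(𝒱)` of pair-copula densities `c_e` for the edges of `G`. Since `c_e` need not be
symmetric, it comes with an order `(a_e, b_e)` of the conditioned set. -/
structure PairCopulas {ι : Type} [DecidableEq ι] (G : GraphSeq ι) where
  a : ∀ k : ℕ, Sym2 (VineNode ι k) → ι
  b : ∀ k : ℕ, Sym2 (VineNode ι k) → ι
  c : ∀ k : ℕ, Sym2 (VineNode ι k) → ℝ × ℝ → ℝ≥0
  isConditioned : ∀ k, ∀ e ∈ G.E k, IsConditioned k e (a k e) (b k e)
  isCopulaDensity : ∀ k, ∀ e ∈ G.E k, IsCopulaDensity (c k e)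

/-- The subvector `U_D`. -/
def subvec {ι : Type} {Ω : Type*} (U : ι → Ω → ℝ) (D : Finset ι) (ω : Ω) : D → ℝ := fun i => U i ω

/-- The random variable `U_{a|D} = C_{a|D}(U_a | U_D)`, where `C_{a|D}` is the conditional
distribution function of `U_a` given `U_D`. -/
noncomputable def condPIT {ι : Type} {Ω : Type*} [MeasurableSpace Ω] (P : Measure Ω) [IsFiniteMeasure P]
    (U : ι → Ω → ℝ) (a : ι) (D : Finset ι) (ω : Ω) : ℝ :=
  (condDistrib (U a) (subvec U D) P (subvec U D ω)).real (Iic (U a ω))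

/-- The random vector `U` follows the (simplified) vine copula model `(G, C)`: its margins are
uniform on `[0, 1]`, and for every edge `e`, the conditional copula of `(U_{a_e}, U_{b_e})` given
`U_{D_e}` has density `c_e`. That is, conditionally on `U_{D_e}`, the pair
`(U_{a_e|D_e}, U_{b_e|D_e})` has density `c_e`, whatever the value of `U_{D_e}`. -/
structure IsVineCopulaModel {ι : Type} {Ω : Type*} [DecidableEq ι] [MeasurableSpace Ω] (P : Measure Ω)
    [IsProbabilityMeasure P] (U : ι → Ω → ℝ) (G : GraphSeq ι) (C : PairCopulas G) : Prop where
  measurable : ∀ i ∈ G.S, Measurable (U i)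
  margin : ∀ i ∈ G.S, HasLaw (U i) stdUniform P
  law_pair : ∀ k, ∀ e ∈ G.E k,
    HasLaw (fun ω => (condPIT P U (C.a k e) (condSet k e) ω, condPIT P U (C.b k e) (condSet k e) ω))
      (pairMeasure (C.c k e)) P
  indep_pair : ∀ k, ∀ e ∈ G.E k,
    IndepFun
      (fun ω => (condPIT P U (C.a k e) (condSet k e) ω, condPIT P U (C.b k e) (condSet k e) ω))
      (subvec U (condSet k e)) P

/-! ### Markov property -/

/-- The σ-algebra generated by `U_s, …, U_t`. -/
@[reducible] def sigmaTimes {d : ℕ} {Ω : Type*} (U : ℤ × Fin d → Ω → ℝ) (s t : ℤ) : MeasurableSpace Ω :=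
  ⨆ i ∈ timeBlock d s t, MeasurableSpace.comap (U i) inferInstance

/-- The time series `U_1, …, U_T` of `d`-dimensional vectors is Markov of order `p`. -/
def IsMarkovOfOrder {d : ℕ} {Ω : Type*} [MeasurableSpace Ω] (P : Measure Ω)
    (U : ℤ × Fin d → Ω → ℝ) (T p : ℕ) : Prop :=
  ∀ t : ℤ, p < t → t ≤ T → ∀ u : Fin d → ℝ,
    P⟦{ω | ∀ j, U (t, j) ω ≤ u j} | sigmaTimes U 1 (t - 1)⟧ =ᵐ[P]
      P⟦{ω | ∀ j, U (t, j) ω ≤ u j} | sigmaTimes U (t - p) (t - 1)⟧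

/-! ### Bridges in acyclic graphs -/

/-! By the chain rule for conditional independence, being Markov of order `p` means that `U_s` and
`U_t` are conditionally independent given everything strictly between, for all `s < t` with `t - s >
p`. The edges lying in none of the restrictions are exactly those whose complete union has earliest
time `s` and latest time `t` with `t - s > p`. So it suffices to treat each pair `s < t` separately
(`Separates.condIndepSubvec_iff`), with `A`, `M`, `B` the blocks of time `s`, between, and `t`.

Stationarity makes the restrictions to `A ∪ M`, `M ∪ B`, `A ∪ M ∪ B` and nonempty `M` vines. The
combinatorial core (`Separates.joinsAcross`) is that an edge inside `A ∪ M ∪ B` meeting both `A` and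
`B` has conditioned elements `a ∈ A`, `b ∈ B` and a conditioning set `D ⊇ M`; otherwise some tree
would contain a cycle.

For such an edge, `c_e = 1` iff `U_a` and `U_b` are conditionally independent given `U_D`
(`isIndepCopula_iff_isCondIndep`), because `U_a` can be recovered almost surely from its conditional
transform and `U_D`. Since `D` consists of `M` and parts of `A` and `B`, independence of `U_A` and
`U_B` given `U_M` implies all these statements by weak union. Conversely they are glued together by
contraction, level by level, up to the top vertex, whose complete union is `A ∪ M ∪ B`. -/

theorem not_reachable_deleteEdges_of_induce_isAcyclic {α : Type*} {H : SimpleGraph α} {s : Set α}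
    (hs : ∀ a b, H.Adj a b → b ∈ s) (hac : (H.induce s).IsAcyclic) {v w : α} (hv : v ∈ s)
    (hvw : H.Adj v w) : ¬ (H.deleteEdges {s(v, w)}).Reachable v w := by
  have hw : w ∈ s := hs v w hvw
  have key : ∀ x y : α, (H.deleteEdges {s(v, w)}).Walk x y → ∀ (hx : x ∈ s) (hy : y ∈ s),
      ((H.induce s).deleteEdges {s(⟨v, hv⟩, ⟨w, hw⟩)}).Reachable ⟨x, hx⟩ ⟨y, hy⟩ := by
    intro x y p
    induction p with
    | nil => intro hx hy; exact SimpleGraph.Reachable.refl _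
    | @cons x z y h p ih =>
      intro hx hy
      rw [SimpleGraph.deleteEdges_adj] at h
      have hz : z ∈ s := hs _ _ h.1
      refine SimpleGraph.Reachable.trans (SimpleGraph.Adj.reachable ?_) (ih hz hy)
      rw [SimpleGraph.deleteEdges_adj]
      refine ⟨h.1, fun h' => h.2 ?_⟩
      have := congrArg (Sym2.map Subtype.val) (mem_singleton_iff.1 h')
      simpa using this
  rintro ⟨p⟩
  have hbr := (SimpleGraph.isAcyclic_iff_forall_adj_isBridge.1 hac)
    (show (H.induce s).Adj ⟨v, hv⟩ ⟨w, hw⟩ from hvw)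
  exact (SimpleGraph.isBridge_iff.1 hbr) (key v w p hv hw)

theorem fromEdgeSet_le_deleteEdges {α : Type*} {E F : Set (Sym2 α)} {e : Sym2 α} (hF : F ⊆ E)
    (he : e ∉ F) : SimpleGraph.fromEdgeSet F ≤ (SimpleGraph.fromEdgeSet E).deleteEdges {e} := by
  intro a b hab
  rw [SimpleGraph.fromEdgeSet_adj] at hab
  rw [SimpleGraph.deleteEdges_adj, SimpleGraph.fromEdgeSet_adj]
  exact ⟨⟨hF hab.1, hab.2⟩, fun h => he (by rw [← mem_singleton_iff.1 h]; exact hab.1)⟩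

namespace GraphSeq

variable {ι : Type}

/-! ### Vertices and edges of vines -/

/-- The restriction of a graph sequence to a subset of the first vertex set. -/
def restr (G : GraphSeq ι) (X : Finset ι) : GraphSeq ι where
  S := X
  E k := {e | e ∈ G.E k ∧ ∀ v ∈ e, v ∈ G.restrictV X k}

theorem restr_V (G : GraphSeq ι) (X : Finset ι) (k : ℕ) : (G.restr X).V k = G.restrictV X k := by
  cases k <;> rfl

/-- A tree has one edge fewer than vertices, and its edges are the next level's vertices. Truncated
subtraction covers the levels past the last tree. -/
theorem IsVine.finite_ncard_V {G : GraphSeq ι} (hG : G.IsVine) (k : ℕ) :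
    (G.V k).Finite ∧ (G.V k).ncard = G.S.card - k := by
  induction k with
  | zero =>
    have h : G.V 0 = (G.S : Set ι) := rfl
    rw [h]
    exact ⟨G.S.finite_toSet, Set.ncard_coe_finset G.S⟩
  | succ k ih =>
    change (G.E k).Finite ∧ (G.E k).ncard = _
    rcases lt_or_ge (k + 1) G.S.card with hk | hk
    · have himg : Sym2.map Subtype.val '' (G.graph k).edgeSet = G.E k := by
        ext e
        constructor
        · rintro ⟨e, he, rfl⟩
          induction e with | _ v w
          have h : (SimpleGraph.fromEdgeSet (G.E k)).Adj v.1 w.1 := he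
          exact ((SimpleGraph.fromEdgeSet_adj _).1 h).1
        · intro he
          induction e with | _ v w
          have h := hG.edge_mem k _ he
          refine ⟨s(⟨v, h.2 v (Sym2.mem_mk_left _ _)⟩, ⟨w, h.2 w (Sym2.mem_mk_right _ _)⟩), ?_, rfl⟩
          change (SimpleGraph.fromEdgeSet (G.E k)).Adj v w
          exact (SimpleGraph.fromEdgeSet_adj _).2 ⟨he, fun hvw => h.1 (by simp [hvw])⟩
      have hinj : Function.Injective (Sym2.map (Subtype.val : G.V k → VineNode ι k)) :=
        Sym2.map.injective Subtype.val_injective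
      have : Finite (G.V k) := ih.1
      have : Fintype (G.V k) := Fintype.ofFinite _
      have hc := (SimpleGraph.isTree_iff_connected_and_card.1 (hG.tree k hk)).2
      rw [← himg]
      refine ⟨(Set.toFinite _).image _, ?_⟩
      rw [Set.ncard_image_of_injective _ hinj]
      have h1 : Nat.card (G.graph k).edgeSet = (G.graph k).edgeSet.ncard := rfl
      have h2 : Nat.card (G.V k) = (G.V k).ncard := rfl
      omega
    · rw [hG.empty k hk]
      refine ⟨Set.finite_empty, ?_⟩
      rw [Set.ncard_empty]
      omega

theorem IsVine.nonempty_V {G : GraphSeq ι} (hG : G.IsVine) {k : ℕ} (hk : k < G.S.card) :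
    (G.V k).Nonempty := by
  have h := hG.finite_ncard_V k
  rw [← Set.ncard_pos h.1]
  omega

theorem IsVine.not_reachable {G : GraphSeq ι} (hG : G.IsVine) {k : ℕ} {v w : VineNode ι k}
    (he : s(v, w) ∈ G.E k) :
    ¬ ((SimpleGraph.fromEdgeSet (G.E k)).deleteEdges {s(v, w)}).Reachable v w := by
  have hvw := hG.edge_mem k _ he
  have hk : k + 1 < G.S.card := by
    by_contra h
    rw [hG.empty k (not_lt.1 h)] at he
    exact he
  refine not_reachable_deleteEdges_of_induce_isAcyclic (s := G.V k) ?_ (hG.tree k hk).isAcyclic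
    (hvw.2 v (Sym2.mem_mk_left _ _)) ((SimpleGraph.fromEdgeSet_adj _).2 ⟨he, fun h => hvw.1 (by simp [h])⟩)
  intro a b hab
  exact (hG.edge_mem k _ ((SimpleGraph.fromEdgeSet_adj _).1 hab).1).2 b (Sym2.mem_mk_right _ _)

theorem IsVine.reachable {G : GraphSeq ι} (hG : G.IsVine) {k : ℕ} {v w : VineNode ι k}
    (hv : v ∈ G.V k) (hw : w ∈ G.V k) : (SimpleGraph.fromEdgeSet (G.E k)).Reachable v w := by
  rcases lt_or_ge (k + 1) G.S.card with hk | hk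
  · have h := (hG.tree k hk).connected.preconnected ⟨v, hv⟩ ⟨w, hw⟩
    exact h.map (SimpleGraph.Embedding.induce (G.V k)).toHom
  · have h := hG.finite_ncard_V k
    have h1 : (G.V k).ncard ≤ 1 := by omega
    rw [(Set.ncard_le_one_iff h.1).1 h1 hv hw]

/-- Two edges of a vine, each of which joins one connected piece to another one, coincide. -/
theorem IsVine.edge_eq {G G₁ G₂ : GraphSeq ι} (hG : G.IsVine) (h₁ : G₁.IsVine) (h₂ : G₂.IsVine)
    {k : ℕ} (hE₁ : G₁.E k ⊆ G.E k) (hE₂ : G₂.E k ⊆ G.E k) {v v' w w' : VineNode ι k}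
    (he : s(v, w) ∈ G.E k) (he' : s(v', w') ∈ G.E k) (hv : v = v' ∨ v ∈ G₁.V k ∧ v' ∈ G₁.V k)
    (hw : w = w' ∨ w ∈ G₂.V k ∧ w' ∈ G₂.V k) (hn₁ : s(v, w) ∉ G₁.E k) (hn₂ : s(v, w) ∉ G₂.E k) :
    s(v, w) = s(v', w') := by
  -- If the edges differed, `v` would still reach `w` after deleting `s(v, w)`: through the first
  -- piece to `v'`, across `s(v', w')`, and back through the second piece.
  by_contra hne
  refine hG.not_reachable he ?_
  have hr₁ : ((SimpleGraph.fromEdgeSet (G.E k)).deleteEdges {s(v, w)}).Reachable v v' := by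
    rcases hv with rfl | hv
    · exact SimpleGraph.Reachable.refl _
    · exact (h₁.reachable hv.1 hv.2).mono (fromEdgeSet_le_deleteEdges hE₁ hn₁)
  have hr₂ : ((SimpleGraph.fromEdgeSet (G.E k)).deleteEdges {s(v, w)}).Reachable w w' := by
    rcases hw with rfl | hw
    · exact SimpleGraph.Reachable.refl _
    · exact (h₂.reachable hw.1 hw.2).mono (fromEdgeSet_le_deleteEdges hE₂ hn₂)
  refine hr₁.trans (SimpleGraph.Reachable.trans (SimpleGraph.Adj.reachable ?_) hr₂.symm)
  rw [SimpleGraph.deleteEdges_adj, SimpleGraph.fromEdgeSet_adj]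
  refine ⟨⟨he', fun h => (hG.edge_mem k _ he').1 (by simp [h])⟩, fun h => hne (mem_singleton_iff.1 h).symm⟩

/-- An edge of a vine cannot join two connected pieces that have a vertex in common, unless it
belongs to one of them. -/
theorem IsVine.mem_or_mem {G G₁ G₂ : GraphSeq ι} (hG : G.IsVine) (h₁ : G₁.IsVine) (h₂ : G₂.IsVine)
    {k : ℕ} (hE₁ : G₁.E k ⊆ G.E k) (hE₂ : G₂.E k ⊆ G.E k) {u v w : VineNode ι k}
    (he : s(v, w) ∈ G.E k) (hv : v ∈ G₁.V k) (hw : w ∈ G₂.V k) (hu₁ : u ∈ G₁.V k)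
    (hu₂ : u ∈ G₂.V k) : s(v, w) ∈ G₁.E k ∨ s(v, w) ∈ G₂.E k := by
  by_contra! hn
  refine hG.not_reachable he ?_
  exact ((h₁.reachable hv hu₁).mono (fromEdgeSet_le_deleteEdges hE₁ hn.1)).trans
    ((h₂.reachable hu₂ hw).mono (fromEdgeSet_le_deleteEdges hE₂ hn.2))

end GraphSeq

theorem exists_eq_mk {ι : Type} {k : ℕ} (e : VineNode ι (k + 1)) :
    ∃ v w : VineNode ι k, e = (s(v, w) : Sym2 (VineNode ι k)) :=
  Sym2.ind (f := fun e => ∃ v w : VineNode ι k, e = s(v, w)) (fun v w => ⟨v, w, rfl⟩) e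

/-! ### Labels, complete unions and restrictions -/

section Labels

variable {ι : Type} [DecidableEq ι]

theorem completeUnion_mk (k : ℕ) (v w : VineNode ι k) :
    completeUnion (k + 1) (s(v, w) : Sym2 (VineNode ι k)) = completeUnion k v ∪ completeUnion k w :=
  rfl

theorem condSet_mk (k : ℕ) (v w : VineNode ι k) :
    condSet k s(v, w) = completeUnion k v ∩ completeUnion k w := rfl

theorem IsConditioned.exists_eq {k : ℕ} {e : Sym2 (VineNode ι k)} {a b : ι}
    (h : IsConditioned k e a b) : ∃ v w, e = s(v, w) ∧ a ∉ condSet k e ∧ b ∉ condSet k e ∧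
      completeUnion k v = insert a (condSet k e) ∧ completeUnion k w = insert b (condSet k e) := by
  obtain ⟨v, w, rfl, ha, hb⟩ := h
  have hD : condSet k s(v, w) = completeUnion k v ∩ completeUnion k w := rfl
  simp only [Finset.ext_iff, Finset.mem_sdiff, Finset.mem_singleton] at ha hb
  refine ⟨v, w, rfl, ((ha a).2 rfl).2, ((hb b).2 rfl).2, ?_, ?_⟩
  · ext x
    have := ha x
    rw [hD] at this ⊢
    simp only [Finset.mem_inter, Finset.mem_insert] at this ⊢
    tauto
  · ext x
    have := hb x
    rw [hD] at this ⊢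
    simp only [Finset.mem_inter, Finset.mem_insert] at this ⊢
    tauto

theorem IsConditioned.symm {k : ℕ} {e : Sym2 (VineNode ι k)} {a b : ι}
    (h : IsConditioned k e a b) : IsConditioned k e b a := by
  obtain ⟨v, w, he, ha, hb⟩ := h
  exact ⟨w, v, he.trans Sym2.eq_swap, hb, ha⟩

theorem IsConditioned.eq_or_eq {k : ℕ} {e : Sym2 (VineNode ι k)} {a b a' b' : ι}
    (h : IsConditioned k e a b) (h' : IsConditioned k e a' b') :
    a = a' ∧ b = b' ∨ a = b' ∧ b = a' := by
  obtain ⟨v, w, he, ha, hb⟩ := h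
  obtain ⟨v', w', he', ha', hb'⟩ := h'
  rw [he] at he'
  rcases Sym2.eq_iff.1 he' with ⟨rfl, rfl⟩ | ⟨rfl, rfl⟩
  · exact Or.inl ⟨Finset.singleton_injective (ha.symm.trans ha'),
      Finset.singleton_injective (hb.symm.trans hb')⟩
  · exact Or.inr ⟨Finset.singleton_injective (ha.symm.trans hb'),
      Finset.singleton_injective (hb.symm.trans ha')⟩

namespace GraphSeq

/-- Unfolding the recursive restriction down to the first level leaves a condition on the elements
used. All later arguments see restrictions through complete unions. -/
theorem mem_restrictV_iff {G : GraphSeq ι} (hG : G.IsVine) (X : Finset ι) {k : ℕ}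
    {v : VineNode ι k} (hv : v ∈ G.V k) : v ∈ G.restrictV X k ↔ completeUnion k v ⊆ X := by
  induction k with
  | zero => exact (Finset.singleton_subset_iff (s := X) (a := (v : ι))).symm
  | succ k ih =>
    obtain ⟨v, w, rfl⟩ := exists_eq_mk v
    have h := (hG.edge_mem k _ hv).2
    rw [completeUnion_mk, Finset.union_subset_iff, ← ih (h v (Sym2.mem_mk_left _ _)),
      ← ih (h w (Sym2.mem_mk_right _ _))]
    change (_ ∈ G.E k ∧ ∀ u ∈ s(v, w), u ∈ G.restrictV X k) ↔ _
    simp only [Sym2.mem_iff, forall_eq_or_imp, forall_eq, and_iff_right_iff_imp]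
    exact fun _ => hv

theorem completeUnion_subset {G : GraphSeq ι} (hG : G.IsVine) {k : ℕ}
    {v : VineNode ι k} (hv : v ∈ G.V k) : completeUnion k v ⊆ G.S := by
  induction k with
  | zero => exact (Finset.singleton_subset_iff (s := G.S) (a := (v : ι))).2 hv
  | succ k ih =>
    obtain ⟨v, w, rfl⟩ := exists_eq_mk v
    have h := (hG.edge_mem k _ hv).2
    rw [completeUnion_mk, Finset.union_subset_iff]
    exact ⟨ih (h v (Sym2.mem_mk_left _ _)), ih (h w (Sym2.mem_mk_right _ _))⟩

theorem mem_restr_V_iff {G : GraphSeq ι} (hG : G.IsVine) {X : Finset ι} (hX : X ⊆ G.S) {k : ℕ}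
    {v : VineNode ι k} : v ∈ (G.restr X).V k ↔ v ∈ G.V k ∧ completeUnion k v ⊆ X := by
  rw [restr_V]
  constructor
  · intro h
    have hv : v ∈ G.V k := by
      cases k with
      | zero => exact hX h
      | succ k => exact h.1
    exact ⟨hv, (mem_restrictV_iff hG X hv).1 h⟩
  · exact fun h => (mem_restrictV_iff hG X h.1).2 h.2

theorem mem_restr_E_iff {G : GraphSeq ι} (hG : G.IsVine) {X : Finset ι} (hX : X ⊆ G.S) {k : ℕ}
    {e : Sym2 (VineNode ι k)} :
    e ∈ (G.restr X).E k ↔ e ∈ G.E k ∧ completeUnion (k + 1) e ⊆ X :=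
  mem_restr_V_iff hG hX (k := k + 1) (v := e)

/-- The complete union of `e` is `D_e` with two new elements, whereas that of an endpoint is `D_e`
with one. In particular `D_e` has `k` elements at level `k`. -/
theorem card_completeUnion {G : GraphSeq ι} (hG : G.IsVine)
    (hc : ∀ k, ∀ e ∈ G.E k, ∃ a b, IsConditioned k e a b) {k : ℕ} {v : VineNode ι k}
    (hv : v ∈ G.V k) : (completeUnion k v).card = k + 1 := by
  induction k with
  | zero => exact Finset.card_singleton _
  | succ k ih =>
    obtain ⟨a, b, hab⟩ := hc k v hv
    obtain ⟨x, y, hxy, ha, hb, hx, hy⟩ := hab.exists_eq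
    have hv' := (hG.edge_mem k _ hv)
    rw [hxy] at hv'
    have h1 := ih (hv'.2 x (Sym2.mem_mk_left _ _))
    have hab' : a ≠ b := by
      rintro rfl
      have hin : a ∈ completeUnion k x ∩ completeUnion k y := by
        rw [hx, hy]; simp
      rw [hxy, condSet_mk] at ha
      exact ha hin
    have hU : completeUnion (k + 1) v = insert a (insert b (condSet k v)) := by
      conv_lhs => rw [show v = (s(x, y) : Sym2 (VineNode ι k)) from hxy, completeUnion_mk, hx, hy]
      ext z; simp only [Finset.mem_union, Finset.mem_insert]; tauto
    rw [hx, Finset.card_insert_of_notMem ha] at h1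
    rw [hU, Finset.card_insert_of_notMem (by simp [hab', ha]), Finset.card_insert_of_notMem hb, h1]

end GraphSeq

end Labels

namespace GraphSeq

variable {ι : Type} [DecidableEq ι]

/-! ### Edges across a separating set -/

/-- `M` separates `A` from `B` in the vine `G`: the restrictions to `A ∪ M`, `M ∪ B` and `M` are
vines. -/
structure Separates (G : GraphSeq ι) (A M B : Finset ι) : Prop where
  isVine : G.IsVine
  isConditioned : ∀ k, ∀ e ∈ G.E k, ∃ a b, IsConditioned k e a b
  subset : A ∪ M ∪ B ⊆ G.S
  disjoint_left : Disjoint A M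
  disjoint_right : Disjoint B M
  disjoint : Disjoint A B
  isVine_left : (G.restr (A ∪ M)).IsVine
  isVine_right : (G.restr (M ∪ B)).IsVine
  isVine_mid : M.Nonempty → (G.restr M).IsVine

/-- A subset of `A ∪ M ∪ B` with elements in `A` and in `B`. -/
def Crosses (A M B N : Finset ι) : Prop :=
  N ⊆ A ∪ M ∪ B ∧ ¬ N ⊆ A ∪ M ∧ ¬ N ⊆ M ∪ B

theorem crosses_iff {A M B N : Finset ι} (hAM : Disjoint A M) (hBM : Disjoint B M)
    (hAB : Disjoint A B) :
    Crosses A M B N ↔ N ⊆ A ∪ M ∪ B ∧ (∃ x ∈ N, x ∈ A) ∧ ∃ x ∈ N, x ∈ B := by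
  have hdl := Finset.disjoint_left.1 hAM
  have hdr := Finset.disjoint_left.1 hBM
  have hd := Finset.disjoint_left.1 hAB
  have hd' := Finset.disjoint_right.1 hAB
  unfold Crosses
  simp only [Finset.not_subset, Finset.mem_union, not_or]
  constructor
  · rintro ⟨h, ⟨x, hx, hx1, hx2⟩, y, hy, hy1, hy2⟩
    refine ⟨h, ⟨y, hy, ?_⟩, x, hx, ?_⟩
    · have := h hy
      simp only [Finset.mem_union] at this
      tauto
    · have := h hx
      simp only [Finset.mem_union] at this
      tauto
  · rintro ⟨h, ⟨x, hx, hxA⟩, y, hy, hyB⟩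
    exact ⟨h, ⟨y, hy, hd' hyB, hdr hyB⟩, x, hx, hdl hxA, hd hxA⟩

/-- `e` joins `D ∪ {a}` to `D ∪ {b}`, where `a ∈ A`, `b ∈ B` and `D ⊇ M`. -/
def JoinsAcross (A M B : Finset ι) (k : ℕ) (e : Sym2 (VineNode ι k)) (v w : VineNode ι k)
    (a b : ι) : Prop :=
  e = s(v, w) ∧ a ∈ A ∧ b ∈ B ∧ a ∉ condSet k e ∧ b ∉ condSet k e ∧
    completeUnion k v = insert a (condSet k e) ∧ completeUnion k w = insert b (condSet k e) ∧
    M ⊆ condSet k e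

theorem JoinsAcross.completeUnion_eq {A M B : Finset ι} {k : ℕ} {e : Sym2 (VineNode ι k)}
    {v w : VineNode ι k} {a b : ι} (h : JoinsAcross A M B k e v w a b) :
    completeUnion (k + 1) e = insert a (insert b (condSet k e)) := by
  obtain ⟨he, -, -, -, -, hv, hw, -⟩ := h
  conv_lhs => rw [he, completeUnion_mk, hv, hw]
  ext z; simp only [Finset.mem_union, Finset.mem_insert]; tauto

theorem JoinsAcross.isConditioned {A M B : Finset ι} {k : ℕ} {e : Sym2 (VineNode ι k)}
    {v w : VineNode ι k} {a b : ι} (h : JoinsAcross A M B k e v w a b) :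
    IsConditioned k e a b := by
  obtain ⟨he, -, -, ha, hb, hv, hw, -⟩ := h
  refine ⟨v, w, he, ?_, ?_⟩
  · rw [hv]; ext z; simp only [Finset.mem_sdiff, Finset.mem_insert, Finset.mem_singleton]
    grind
  · rw [hw]; ext z; simp only [Finset.mem_sdiff, Finset.mem_insert, Finset.mem_singleton]
    grind

variable {G : GraphSeq ι} {A M B : Finset ι}

/-- Passes from crossing vertices at level `k` to crossing edges, by cases on which endpoints cross;
`hM` and `hinj` are the invariants supplied by `crosses_aux`. -/
theorem Separates.exists_joinsAcross (h : G.Separates A M B) {k : ℕ}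
    (hM : ∀ v ∈ G.V k, Crosses A M B (completeUnion k v) → M ⊆ completeUnion k v)
    (hinj : ∀ v ∈ G.V k, ∀ w ∈ G.V k, Crosses A M B (completeUnion k v) →
      Crosses A M B (completeUnion k w) →
      (completeUnion k v ∩ B).card = (completeUnion k w ∩ B).card → v = w)
    {e : Sym2 (VineNode ι k)} (he : e ∈ G.E k) (hcr : Crosses A M B (completeUnion (k + 1) e)) :
    ∃ v w a b, JoinsAcross A M B k e v w a b := by
  obtain ⟨a, b, hab⟩ := h.isConditioned k e he
  obtain ⟨v, w, rfl, ha, hb, hv, hw⟩ := hab.exists_eq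
  have hvw := h.isVine.edge_mem k _ he
  have hvV : v ∈ G.V k := hvw.2 v (Sym2.mem_mk_left _ _)
  have hwV : w ∈ G.V k := hvw.2 w (Sym2.mem_mk_right _ _)
  have hne : v ≠ w := fun h => hvw.1 (by simp [h])
  have hD : condSet k s(v, w) = completeUnion k v ∩ completeUnion k w := rfl
  have hcr' := hcr
  rw [completeUnion_mk] at hcr
  have hcv := card_completeUnion h.isVine h.isConditioned hvV
  have hcw := card_completeUnion h.isVine h.isConditioned hwV
  have hcD : (condSet k s(v, w)).card = k := by
    rw [hv, Finset.card_insert_of_notMem ha] at hcv; omega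
  have hdl := Finset.disjoint_left.1 h.disjoint_left
  have hdr := Finset.disjoint_left.1 h.disjoint_right
  have hd := Finset.disjoint_left.1 h.disjoint
  have hsubl : A ∪ M ⊆ G.S := fun x hx => h.subset (by grind)
  have hsubr : M ∪ B ⊆ G.S := fun x hx => h.subset (by grind)
  have hsubm : M ⊆ G.S := fun x hx => h.subset (by grind)
  -- if neither vertex crosses, then the conditioning set is `M`
  have mid : ∀ x y : VineNode ι k, s(x, y) = s(v, w) → x ∈ G.V k → y ∈ G.V k →
      completeUnion k x ⊆ A ∪ M → completeUnion k y ⊆ M ∪ B → M ⊆ condSet k s(v, w) := by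
    intro x y hxy hx hy hxA hyB
    have hDM : condSet k s(v, w) ⊆ M := by
      rw [← hxy, condSet_mk]
      intro z hz
      rw [Finset.mem_inter] at hz
      have := hxA hz.1
      have := hyB hz.2
      grind
    -- For `k < |M|` the vine on `M` has a vertex at level `k`, shared by the trees on `A ∪ M` and
    -- `M ∪ B`; an edge joining these trees then lies in one of them and does not cross. Otherwise
    -- `|D| = k ≥ |M|` and `D ⊆ M` force `D = M`.
    rcases lt_or_ge k M.card with hk | hk
    · exfalso
      obtain ⟨u, hu⟩ := (h.isVine_mid (Finset.card_pos.1 (by omega))).nonempty_V hk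
      rw [mem_restr_V_iff h.isVine hsubm] at hu
      rcases h.isVine.mem_or_mem h.isVine_left h.isVine_right
        (fun e he => ((mem_restr_E_iff h.isVine hsubl).1 he).1)
        (fun e he => ((mem_restr_E_iff h.isVine hsubr).1 he).1) (hxy ▸ he)
        ((mem_restr_V_iff h.isVine hsubl).2 ⟨hx, hxA⟩)
        ((mem_restr_V_iff h.isVine hsubr).2 ⟨hy, hyB⟩)
        ((mem_restr_V_iff h.isVine hsubl).2 ⟨hu.1, hu.2.trans Finset.subset_union_right⟩)
        ((mem_restr_V_iff h.isVine hsubr).2 ⟨hu.1, hu.2.trans Finset.subset_union_left⟩) with h1 | h1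
      · exact hcr'.2.1 (hxy ▸ ((mem_restr_E_iff h.isVine hsubl).1 h1).2)
      · exact hcr'.2.2 (hxy ▸ ((mem_restr_E_iff h.isVine hsubr).1 h1).2)
    · rw [Finset.eq_of_subset_of_card_le hDM (by omega)]
  have key : (M ⊆ condSet k s(v, w) ∧ a ∈ A ∧ b ∈ B) ∨ (M ⊆ condSet k s(v, w) ∧ b ∈ A ∧ a ∈ B) := by
    have hvN : completeUnion k v ⊆ A ∪ M ∪ B := Finset.subset_union_left.trans hcr.1
    have hwN : completeUnion k w ⊆ A ∪ M ∪ B := Finset.subset_union_right.trans hcr.1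
    by_cases hv1 : completeUnion k v ⊆ A ∪ M
    · by_cases hw1 : completeUnion k w ⊆ A ∪ M
      · exact absurd (Finset.union_subset hv1 hw1) hcr.2.1
      · by_cases hw2 : completeUnion k w ⊆ M ∪ B
        · have := mid v w rfl hvV hwV hv1 hw2
          grind
        -- Only `w` crosses: `D ⊆ A ∪ M` misses `B`, so `b ∈ B`; then `M ⊆ D`, and `a ∉ D` leaves `a
        -- ∈ A`.
        · have := hM w hwV ⟨hwN, hw1, hw2⟩
          grind
    · by_cases hv2 : completeUnion k v ⊆ M ∪ B
      · by_cases hw2 : completeUnion k w ⊆ M ∪ B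
        · exact absurd (Finset.union_subset hv2 hw2) hcr.2.2
        · by_cases hw1 : completeUnion k w ⊆ A ∪ M
          · have := mid w v Sym2.eq_swap hwV hvV hw1 hv2
            grind
          · have := hM w hwV ⟨hwN, hw1, hw2⟩
            grind
      · have hMv := hM v hvV ⟨hvN, hv1, hv2⟩
        by_cases hw1 : completeUnion k w ⊆ A ∪ M
        · grind
        · by_cases hw2 : completeUnion k w ⊆ M ∪ B
          · grind
          · have hMw := hM w hwV ⟨hwN, hw1, hw2⟩
            have hMD : M ⊆ condSet k s(v, w) := Finset.subset_inter hMv hMw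
            -- Both endpoints cross. With `a` and `b` on the same side they would have equally many
            -- elements in `B`, hence coincide.
            have hiff : (a ∈ B ↔ b ∈ B) → False := by
              intro hiff
              refine hne (hinj v hvV w hwV ⟨hvN, hv1, hv2⟩ ⟨hwN, hw1, hw2⟩ ?_)
              rw [hv, hw]
              by_cases haB : a ∈ B
              · rw [Finset.insert_inter_of_mem haB, Finset.insert_inter_of_mem (hiff.1 haB),
                  Finset.card_insert_of_notMem (fun h => ha (Finset.mem_inter.1 h).1),
              Finset.card_insert_of_notMem (fun h => hb (Finset.mem_inter.1 h).1)]
              · rw [Finset.insert_inter_of_notMem haB,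
                  Finset.insert_inter_of_notMem (fun hbB => haB (hiff.2 hbB))]
            have haN : a ∈ A ∪ M ∪ B := hvN (by rw [hv]; simp)
            have hbN : b ∈ A ∪ M ∪ B := hwN (by rw [hw]; simp)
            grind
  rcases key with hk | hk
  · exact ⟨v, w, a, b, rfl, hk.2.1, hk.2.2, ha, hb, hv, hw, hk.1⟩
  · exact ⟨w, v, b, a, Sym2.eq_swap, hk.2.1, hk.2.2, hb, ha, hw, hv, hk.1⟩

/-- The two invariants must climb the levels together: uniqueness of a crossing vertex with a given
number of elements in `B` is what excludes, one level up, an edge with both conditioned elements on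
one side. -/
theorem Separates.crosses_aux (h : G.Separates A M B) (k : ℕ) :
    (∀ v ∈ G.V k, Crosses A M B (completeUnion k v) → M ⊆ completeUnion k v) ∧
    (∀ v ∈ G.V k, ∀ w ∈ G.V k, Crosses A M B (completeUnion k v) →
      Crosses A M B (completeUnion k w) →
      (completeUnion k v ∩ B).card = (completeUnion k w ∩ B).card → v = w) := by
  have hsubl : A ∪ M ⊆ G.S := fun x hx => h.subset (by grind)
  have hsubr : M ∪ B ⊆ G.S := fun x hx => h.subset (by grind)
  induction k with
  | zero =>
    have hz : ∀ v : VineNode ι 0, ¬ Crosses A M B (completeUnion 0 v) := by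
      rintro (v : ι) hv
      have hU : completeUnion 0 (v : VineNode ι 0) = ({v} : Finset ι) := rfl
      rw [hU] at hv
      simp only [Crosses, Finset.singleton_subset_iff] at hv
      grind
    exact ⟨fun v _ hv => absurd hv (hz v), fun v _ w _ hv => absurd hv (hz v)⟩
  | succ k ih =>
    refine ⟨fun e he hcr => ?_, fun e he e' he' hcr hcr' hf => ?_⟩
    · obtain ⟨v, w, a, b, hJ⟩ := h.exists_joinsAcross ih.1 ih.2 he hcr
      have := hJ.completeUnion_eq
      obtain ⟨-, -, -, -, -, -, -, hM⟩ := hJ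
      grind
    · obtain ⟨v, w, a, b, hJ⟩ := h.exists_joinsAcross ih.1 ih.2 he hcr
      obtain ⟨v', w', a', b', hJ'⟩ := h.exists_joinsAcross ih.1 ih.2 he' hcr'
      have hU := hJ.completeUnion_eq
      have hU' := hJ'.completeUnion_eq
      obtain ⟨hev, haA, hbB, ha, hb, hv, hw, hM⟩ := hJ
      obtain ⟨hev', haA', hbB', ha', hb', hv', hw', hM'⟩ := hJ'
      have hdl := Finset.disjoint_left.1 h.disjoint_left
      have hdr := Finset.disjoint_left.1 h.disjoint_right
      have hd := Finset.disjoint_left.1 h.disjoint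
      have hvw := h.isVine.edge_mem k _ he
      have hvw' := h.isVine.edge_mem k _ he'
      have hvV : v ∈ G.V k := hvw.2 v (by rw [hev]; exact Sym2.mem_mk_left _ _)
      have hwV : w ∈ G.V k := hvw.2 w (by rw [hev]; exact Sym2.mem_mk_right _ _)
      have hvV' : v' ∈ G.V k := hvw'.2 v' (by rw [hev']; exact Sym2.mem_mk_left _ _)
      have hwV' : w' ∈ G.V k := hvw'.2 w' (by rw [hev']; exact Sym2.mem_mk_right _ _)
      have hcr₁ := hcr
      have hcr₁' := hcr'
      have hcv := card_completeUnion h.isVine h.isConditioned hvV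
      have hcv' := card_completeUnion h.isVine h.isConditioned hvV'
      simp only [Crosses] at hcr hcr'
      rw [hU] at hcr hf
      rw [hU'] at hcr' hf
      set D := condSet k e with hD
      set D' := condSet k e' with hD'
      rw [hv, Finset.card_insert_of_notMem ha] at hcv
      rw [hv', Finset.card_insert_of_notMem ha'] at hcv'
      have hfD : (D ∩ B).card = (D' ∩ B).card := by
        rw [Finset.insert_inter_of_notMem (hd haA), Finset.insert_inter_of_mem hbB,
          Finset.insert_inter_of_notMem (hd haA'), Finset.insert_inter_of_mem hbB',
          Finset.card_insert_of_notMem (fun h => hb (Finset.mem_inter.1 h).1),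
              Finset.card_insert_of_notMem (fun h => hb' (Finset.mem_inter.1 h).1)] at hf
        omega
      have hDN : D ⊆ A ∪ M ∪ B := fun x hx => hcr.1 (by grind)
      have hDN' : D' ⊆ A ∪ M ∪ B := fun x hx => hcr'.1 (by grind)
      have hcount : ∀ N : Finset ι, N ⊆ A ∪ M ∪ B → M ⊆ N →
          N.card = (N ∩ A).card + M.card + (N ∩ B).card := by
        intro N hN hMN
        have : N = (N ∩ A) ∪ M ∪ (N ∩ B) := by
          ext x
          have := @hN x
          have := @hMN x
          grind
        conv_lhs => rw [this]
        rw [Finset.card_union_of_disjoint, Finset.card_union_of_disjoint]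
        · exact h.disjoint_left.mono_left Finset.inter_subset_right
        · rw [Finset.disjoint_left]; grind
      -- `D` and `D'` have the same size, both contain `M`, and agree in their count in `B`.
      have hfA : (D ∩ A).card = (D' ∩ A).card := by
        have := hcount D hDN hM
        have := hcount D' hDN' hM'
        omega
      have hsplit : ∀ N X Y : Finset ι, N ⊆ A ∪ M ∪ B → (N ∩ X).card = 0 → X ∪ Y = A ∪ M ∪ B →
          N ⊆ Y := by
        intro N X Y hN hX hXY z hz
        have h1 := hN hz
        rw [← hXY] at h1
        rw [Finset.card_eq_zero] at hX
        have : z ∉ N ∩ X := by rw [hX]; simp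
        grind
      have hside : ∀ N X : Finset ι, (N ∩ X).card ≠ 0 → ∃ z, z ∈ N ∧ z ∈ X := by
        intro N X hNX
        obtain ⟨z, hz⟩ := Finset.card_ne_zero.1 hNX
        exact ⟨z, Finset.mem_inter.1 hz⟩
      have hcross := fun {N : Finset ι} =>
        crosses_iff (N := N) h.disjoint_left h.disjoint_right h.disjoint
      -- If `D` misses `B`, so does `D'`, and both vertices lie in the tree on `A ∪ M`. Otherwise
      -- both cross with equal counts in `B` and the induction hypothesis identifies them. `hww` is
      -- the mirror image.
      have hvv : v = v' ∨ v ∈ (G.restr (A ∪ M)).V k ∧ v' ∈ (G.restr (A ∪ M)).V k := by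
        rw [mem_restr_V_iff h.isVine hsubl, mem_restr_V_iff h.isVine hsubl]
        by_cases h0 : (D ∩ B).card = 0
        · have h1 := hsplit D B (A ∪ M) hDN h0 (Finset.union_comm _ _)
          have h2 := hsplit D' B (A ∪ M) hDN' (hfD ▸ h0) (Finset.union_comm _ _)
          rw [hv, hv']
          exact Or.inr ⟨⟨hvV, Finset.insert_subset (by simp [haA]) h1⟩,
            hvV', Finset.insert_subset (by simp [haA']) h2⟩
        · obtain ⟨z, hz⟩ := hside D B h0
          obtain ⟨z', hz'⟩ := hside D' B (hfD ▸ h0)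
          refine Or.inl (ih.2 v hvV v' hvV' ?_ ?_ ?_)
          · rw [hv]; exact hcross.2 ⟨Finset.insert_subset (hcr.1 (by simp)) hDN,
              ⟨a, by simp, haA⟩, z, by simp [hz.1], hz.2⟩
          · rw [hv']; exact hcross.2 ⟨Finset.insert_subset (hcr'.1 (by simp)) hDN',
              ⟨a', by simp, haA'⟩, z', by simp [hz'.1], hz'.2⟩
          · rw [hv, hv', Finset.insert_inter_of_notMem (hd haA),
              Finset.insert_inter_of_notMem (hd haA'), hfD]
      have hww : w = w' ∨ w ∈ (G.restr (M ∪ B)).V k ∧ w' ∈ (G.restr (M ∪ B)).V k := by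
        rw [mem_restr_V_iff h.isVine hsubr, mem_restr_V_iff h.isVine hsubr]
        by_cases h0 : (D ∩ A).card = 0
        · have h1 := hsplit D A (M ∪ B) hDN h0 (Finset.union_assoc _ _ _).symm
          have h2 := hsplit D' A (M ∪ B) hDN' (hfA ▸ h0) (Finset.union_assoc _ _ _).symm
          rw [hw, hw']
          exact Or.inr ⟨⟨hwV, Finset.insert_subset (by simp [hbB]) h1⟩,
            hwV', Finset.insert_subset (by simp [hbB']) h2⟩
        · obtain ⟨z, hz⟩ := hside D A h0
          obtain ⟨z', hz'⟩ := hside D' A (hfA ▸ h0)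
          refine Or.inl (ih.2 w hwV w' hwV' ?_ ?_ ?_)
          · rw [hw]; exact hcross.2 ⟨Finset.insert_subset (hcr.1 (by simp)) hDN,
              ⟨z, by simp [hz.1], hz.2⟩, b, by simp, hbB⟩
          · rw [hw']; exact hcross.2 ⟨Finset.insert_subset (hcr'.1 (by simp)) hDN',
              ⟨z', by simp [hz'.1], hz'.2⟩, b', by simp, hbB'⟩
          · rw [hw, hw', Finset.insert_inter_of_mem hbB, Finset.insert_inter_of_mem hbB',
              Finset.card_insert_of_notMem (fun h => hb (Finset.mem_inter.1 h).1),
              Finset.card_insert_of_notMem (fun h => hb' (Finset.mem_inter.1 h).1), hfD]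
      have hnl : s(v, w) ∉ (G.restr (A ∪ M)).E k := fun hE =>
        hcr₁.2.1 (by rw [hev]; exact ((mem_restr_E_iff h.isVine hsubl).1 hE).2)
      have hnr : s(v, w) ∉ (G.restr (M ∪ B)).E k := fun hE =>
        hcr₁.2.2 (by rw [hev]; exact ((mem_restr_E_iff h.isVine hsubr).1 hE).2)
      exact hev.trans ((h.isVine.edge_eq h.isVine_left h.isVine_right
        (fun e he => ((mem_restr_E_iff h.isVine hsubl).1 he).1)
        (fun e he => ((mem_restr_E_iff h.isVine hsubr).1 he).1)
        (hev ▸ he) (hev' ▸ he') hvv hww hnl hnr).trans hev'.symm)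

/-- Every edge with elements in both `A` and `B` has one conditioned element in `A` and one in `B`,
and its conditioning set contains `M`. -/
theorem Separates.joinsAcross (h : G.Separates A M B) {k : ℕ} {e : Sym2 (VineNode ι k)}
    (he : e ∈ G.E k) (hcr : Crosses A M B (completeUnion (k + 1) e)) :
    ∃ v w a b, JoinsAcross A M B k e v w a b :=
  h.exists_joinsAcross (h.crosses_aux k).1 (h.crosses_aux k).2 he hcr

end GraphSeq

/-! ### Conditional independence of σ-algebras -/

section CondIndependence

variable {Ω : Type*} {m₁ m₁' m₂ m₂' m : MeasurableSpace Ω} {mΩ : MeasurableSpace Ω}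
  {P : Measure Ω}

/-- `m₁` and `m₂` are conditionally independent given `m`. -/
def IsCondIndep {mΩ : MeasurableSpace Ω} (P : Measure Ω) (m₁ m₂ m : MeasurableSpace Ω) : Prop :=
  ∀ t, MeasurableSet[m₂] t → P⟦t | m₁ ⊔ m⟧ =ᵐ[P] P⟦t | m⟧

theorem IsCondIndep.mono_right (h : IsCondIndep P m₁ m₂ m) (hle : m₂' ≤ m₂) :
    IsCondIndep P m₁ m₂' m := fun t ht => h t (hle t ht)

theorem IsCondIndep.sup_left (h : IsCondIndep P m₁ m₂ m) : IsCondIndep P (m₁ ⊔ m) m₂ m := by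
  intro t ht
  rw [sup_assoc, sup_idem]
  exact h t ht

/-- Conditional probabilities do not see null sets; this allows a variable to be replaced by one
that determines it only almost surely. -/
theorem IsCondIndep.eventually_right (h : IsCondIndep P m₁ m₂ m)
    (hle : m₂' ≤ eventuallyMeasurableSpace m₂ (ae P)) : IsCondIndep P m₁ m₂' m := by
  intro t ht
  obtain ⟨t', ht', htt'⟩ := hle t ht
  have hi : t.indicator (fun _ => (1 : ℝ)) =ᵐ[P] t'.indicator (fun _ => (1 : ℝ)) :=
    indicator_ae_eq_of_ae_eq_set htt'
  exact (condExp_congr_ae hi).trans ((h t' ht').trans (condExp_congr_ae hi).symm)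

theorem setIntegral_eq_of_isPiSystem (hm : m ≤ mΩ) {π : Set (Set Ω)}
    (hπ : IsPiSystem π) (hgen : m = MeasurableSpace.generateFrom π) (huniv : univ ∈ π)
    {f g : Ω → ℝ} (hf : Integrable f P) (hg : Integrable g P)
    (h : ∀ s ∈ π, ∫ ω in s, f ω ∂P = ∫ ω in s, g ω ∂P) (s : Set Ω) (hs : MeasurableSet[m] s) :
    ∫ ω in s, f ω ∂P = ∫ ω in s, g ω ∂P := by
  induction s, hs using MeasurableSpace.induction_on_inter hgen hπ with
  | empty => simp
  | basic t ht => exact h t ht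
  | compl t ht ih =>
    have h0 := h univ huniv
    simp only [setIntegral_univ] at h0
    have h1 := integral_add_compl (hm t ht) hf
    have h2 := integral_add_compl (hm t ht) hg
    linarith
  | iUnion s hd hs ih =>
    rw [integral_iUnion (fun i => hm _ (hs i)) hd hf.integrableOn,
      integral_iUnion (fun i => hm _ (hs i)) hd hg.integrableOn]
    simp_rw [ih]

variable [IsFiniteMeasure P]

/-- The chain rule: decomposition, weak union and contraction in one equivalence, by the tower
property. -/
theorem isCondIndep_sup_left_iff (h₁ : m₁ ≤ mΩ) (h₁' : m₁' ≤ mΩ) (hm : m ≤ mΩ) :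
    IsCondIndep P (m₁ ⊔ m₁') m₂ m ↔ IsCondIndep P m₁' m₂ m ∧ IsCondIndep P m₁ m₂ (m₁' ⊔ m) := by
  constructor
  · intro h
    have h' : IsCondIndep P m₁' m₂ m := by
      intro t ht
      have h1 := h t ht
      have h2 : P[P⟦t | m₁ ⊔ m₁' ⊔ m⟧ | m₁' ⊔ m] =ᵐ[P] P⟦t | m₁' ⊔ m⟧ :=
        condExp_condExp_of_le (sup_le_sup_right le_sup_right _) (sup_le (sup_le h₁ h₁') hm)
      have h3 : P[P⟦t | m⟧ | m₁' ⊔ m] = P⟦t | m⟧ :=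
        condExp_of_stronglyMeasurable (sup_le h₁' hm)
          (stronglyMeasurable_condExp.mono le_sup_right) integrable_condExp
      exact h2.symm.trans ((condExp_congr_ae h1).trans (by rw [h3]))
    refine ⟨h', fun t ht => ?_⟩
    rw [← sup_assoc]
    exact (h t ht).trans (h' t ht).symm
  · rintro ⟨h, h'⟩ t ht
    rw [sup_assoc]
    exact (h' t ht).trans (h t ht)

theorem IsCondIndep.mono_left (h : IsCondIndep P m₁ m₂ m) (h₁ : m₁ ≤ mΩ) (hm : m ≤ mΩ)
    (hle : m₁' ≤ m₁) : IsCondIndep P m₁' m₂ m := by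
  rw [← sup_eq_left.2 hle] at h
  exact ((isCondIndep_sup_left_iff h₁ (hle.trans h₁) hm).1 h).1

theorem setIntegral_inter_eq_setIntegral_condExp_mul (hm : m ≤ mΩ) {t c : Set Ω}
    (ht : MeasurableSet t) (hc : MeasurableSet[m] c) {g : Ω → ℝ} (hg : StronglyMeasurable[m] g)
    (hgi : Integrable g P) : ∫ ω in t ∩ c, g ω ∂P = ∫ ω in c, (P⟦t | m⟧) ω * g ω ∂P := by
  have hmul : (t.indicator (fun _ => (1 : ℝ))) * g = t.indicator g := by
    ext ω; by_cases hω : ω ∈ t <;> simp [hω]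
  have h1 := condExp_mul_of_stronglyMeasurable_right (μ := P) (m := m)
    (f := t.indicator (fun _ => (1 : ℝ))) hg
    (by rw [hmul]; exact hgi.indicator ht) ((integrable_const 1).indicator ht)
  calc ∫ ω in t ∩ c, g ω ∂P = ∫ ω in c, t.indicator g ω ∂P := by
        rw [setIntegral_indicator ht, inter_comm]
    _ = ∫ ω in c, P[t.indicator g | m] ω ∂P := (setIntegral_condExp hm (hgi.indicator ht) hc).symm
    _ = ∫ ω in c, (P⟦t | m⟧) ω * g ω ∂P := by
        refine setIntegral_congr_ae (hm c hc) ?_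
        rw [hmul] at h1
        filter_upwards [h1] with ω hω _ using hω

theorem generateFrom_image2_inter {π : Set (Set Ω)} (huniv : univ ∈ π) :
    MeasurableSpace.generateFrom π ⊔ m =
      MeasurableSpace.generateFrom (image2 (· ∩ ·) π {c | MeasurableSet[m] c}) := by
  apply le_antisymm
  · refine sup_le (MeasurableSpace.generateFrom_le fun t ht => ?_) fun c hc => ?_
    · exact MeasurableSpace.measurableSet_generateFrom ⟨t, ht, univ, MeasurableSet.univ, inter_univ t⟩
    · exact MeasurableSpace.measurableSet_generateFrom ⟨univ, huniv, c, hc, univ_inter c⟩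
  · refine MeasurableSpace.generateFrom_le ?_
    rintro _ ⟨t, ht, c, hc, rfl⟩
    refine @MeasurableSet.inter _ (_) _ _ ?_ ?_
    · exact le_sup_left (a := MeasurableSpace.generateFrom π) (b := m) _
        (MeasurableSpace.measurableSet_generateFrom ht)
    · exact le_sup_right (a := MeasurableSpace.generateFrom π) (b := m) _ hc

/-- For `c` in `m`, the integral of `P⟦s | m⟧` over `t ∩ c` is that of `P⟦s | m⟧ * P⟦t | m⟧` over
`c`, which is symmetric in `s` and `t`. Testing on a π-system suffices, and the Markov property
provides only lower orthants. -/
theorem IsCondIndep.symm_of_generateFrom (h₁ : m₁ ≤ mΩ) (h₂ : m₂ ≤ mΩ) (hm : m ≤ mΩ)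
    {π : Set (Set Ω)} (hπ : IsPiSystem π) (hgen : m₂ = MeasurableSpace.generateFrom π)
    (h : ∀ t ∈ π, P⟦t | m₁ ⊔ m⟧ =ᵐ[P] P⟦t | m⟧) : IsCondIndep P m₂ m₁ m := by
  intro s hs
  have hπ' : IsPiSystem (insert univ π) := hπ.insert_univ
  have hgen' : m₂ = MeasurableSpace.generateFrom (insert univ π) := by
    rw [MeasurableSpace.generateFrom_insert_univ, hgen]
  have h' : ∀ t ∈ insert univ π, P⟦t | m₁ ⊔ m⟧ =ᵐ[P] P⟦t | m⟧ := by
    rintro t (rfl | ht)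
    · simp only [indicator_univ]
      rw [condExp_const (sup_le h₁ hm), condExp_const hm]
    · exact h t ht
  have hsm : MeasurableSet s := h₁ s hs
  have hsi : Integrable (s.indicator fun _ => (1 : ℝ)) P := (integrable_const 1).indicator hsm
  have hsts : StronglyMeasurable[m₂ ⊔ m] (P⟦s | m⟧) := stronglyMeasurable_condExp.mono le_sup_right
  refine (ae_eq_condExp_of_forall_setIntegral_eq (sup_le h₂ hm) hsi
    (fun _ _ _ => integrable_condExp.integrableOn) (fun r hr _ => ?_)
    hsts.aestronglyMeasurable).symm
  refine setIntegral_eq_of_isPiSystem (sup_le h₂ hm) ?_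
    (by rw [hgen']; exact generateFrom_image2_inter (m := m) (mem_insert univ π)) ?_
    integrable_condExp hsi ?_ r hr
  · rintro _ ⟨t, ht, c, hc, rfl⟩ _ ⟨t', ht', c', hc', rfl⟩ hne
    simp only [inter_inter_inter_comm t c t' c'] at hne ⊢
    exact ⟨t ∩ t', hπ' t ht t' ht' (hne.mono inter_subset_left), c ∩ c',
      @MeasurableSet.inter _ m _ _ hc hc', rfl⟩
  · exact ⟨univ, mem_insert _ _, univ, MeasurableSet.univ, inter_univ _⟩
  · rintro _ ⟨t, ht, c, hc, rfl⟩
    have htm : MeasurableSet t := h₂ t (by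
      rw [hgen']; exact MeasurableSpace.measurableSet_generateFrom ht)
    have hti : Integrable (t.indicator fun _ => (1 : ℝ)) P := (integrable_const 1).indicator htm
    have hcm := hm c hc
    have hsc : MeasurableSet[m₁ ⊔ m] (s ∩ c) := @MeasurableSet.inter _ (_) _ _
      (le_sup_left (a := m₁) (b := m) _ hs) (le_sup_right (a := m₁) (b := m) _ hc)
    calc ∫ ω in t ∩ c, (P⟦s | m⟧) ω ∂P
        = ∫ ω in c, (P⟦t | m⟧) ω * (P⟦s | m⟧) ω ∂P :=
          setIntegral_inter_eq_setIntegral_condExp_mul hm htm hc stronglyMeasurable_condExp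
            integrable_condExp
      _ = ∫ ω in c, (P⟦s | m⟧) ω * (P⟦t | m⟧) ω ∂P := by simp_rw [mul_comm]
      _ = ∫ ω in s ∩ c, (P⟦t | m⟧) ω ∂P :=
          (setIntegral_inter_eq_setIntegral_condExp_mul hm hsm hc stronglyMeasurable_condExp
            integrable_condExp).symm
      _ = ∫ ω in s ∩ c, (P⟦t | m₁ ⊔ m⟧) ω ∂P :=
          setIntegral_congr_ae (hsm.inter hcm) (by filter_upwards [h' t ht] with ω hω _ using hω.symm)
      _ = ∫ ω in s ∩ c, t.indicator (fun _ => (1 : ℝ)) ω ∂P :=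
          setIntegral_condExp (sup_le h₁ hm) hti hsc
      _ = ∫ ω in t ∩ c, s.indicator (fun _ => (1 : ℝ)) ω ∂P := by
          rw [setIntegral_indicator htm, setIntegral_indicator hsm]
          congr 2
          ext ω; simp only [mem_inter_iff]; tauto

theorem IsCondIndep.symm (h : IsCondIndep P m₁ m₂ m) (h₁ : m₁ ≤ mΩ) (h₂ : m₂ ≤ mΩ) (hm : m ≤ mΩ) :
    IsCondIndep P m₂ m₁ m :=
  IsCondIndep.symm_of_generateFrom h₁ h₂ hm (π := {t | MeasurableSet[m₂] t})
    (fun _ hs _ ht _ => @MeasurableSet.inter _ m₂ _ _ hs ht)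
    (@MeasurableSpace.generateFrom_measurableSet _ m₂).symm h

theorem IsCondIndep.sup_sup (h : IsCondIndep P m₁ m₂ m) (h₁ : m₁ ≤ mΩ) (h₂ : m₂ ≤ mΩ)
    (hm : m ≤ mΩ) : IsCondIndep P (m₁ ⊔ m) (m₂ ⊔ m) m :=
  ((h.symm h₁ h₂ hm).sup_left.symm (sup_le h₂ hm) h₁ hm).sup_left

end CondIndependence

/-! ### σ-algebras generated by subvectors -/

section SigmaOf

variable {ι : Type} {Ω : Type*}

/-- The σ-algebra generated by the subvector `U_D`. -/
@[reducible] def sigmaOf (U : ι → Ω → ℝ) (D : Finset ι) : MeasurableSpace Ω :=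
  ⨆ i ∈ D, MeasurableSpace.comap (U i) inferInstance

theorem sigmaOf_union [DecidableEq ι] (U : ι → Ω → ℝ) (D E : Finset ι) :
    sigmaOf U (D ∪ E) = sigmaOf U D ⊔ sigmaOf U E := Finset.iSup_union

theorem sigmaOf_singleton (U : ι → Ω → ℝ) (a : ι) :
    sigmaOf U {a} = MeasurableSpace.comap (U a) inferInstance :=
  Finset.iSup_singleton _ _

theorem sigmaOf_mono (U : ι → Ω → ℝ) {D E : Finset ι} (h : D ⊆ E) : sigmaOf U D ≤ sigmaOf U E :=
  biSup_mono fun _ hi => h hi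

theorem sigmaOf_le [mΩ : MeasurableSpace Ω] {U : ι → Ω → ℝ} {S D : Finset ι}
    (hU : ∀ i ∈ S, Measurable (U i)) (hD : D ⊆ S) : sigmaOf U D ≤ mΩ :=
  iSup₂_le fun i hi => (hU i (hD hi)).comap_le

theorem comap_subvec (U : ι → Ω → ℝ) (D : Finset ι) :
    MeasurableSpace.comap (subvec U D) inferInstance = sigmaOf U D := by
  change MeasurableSpace.comap (subvec U D) MeasurableSpace.pi = _
  rw [MeasurableSpace.pi, MeasurableSpace.comap_iSup]
  simp_rw [MeasurableSpace.comap_comp]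
  exact iSup_subtype (p := fun i => i ∈ D)
    (f := fun i => MeasurableSpace.comap (U i) (inferInstance : MeasurableSpace ℝ))

end SigmaOf

/-! ### The conditional probability integral transform -/

section CondTransform

variable {Ω E : Type*} {mΩ : MeasurableSpace Ω} [mE : MeasurableSpace E] {P : Measure Ω}
  [IsProbabilityMeasure P] {X : Ω → E} {Y Z : Ω → ℝ}

/-- The conditional distribution function of `Y` given `X`, evaluated at `(X, Y)`. -/
noncomputable def condTransform (P : Measure Ω) [IsFiniteMeasure P] (Y : Ω → ℝ) (X : Ω → E)
    (ω : Ω) : ℝ :=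
  (condDistrib Y X P (X ω)).real (Iic (Y ω))

theorem measurable_condTransform :
    Measurable[MeasurableSpace.comap Y inferInstance ⊔ MeasurableSpace.comap X mE]
      (condTransform P Y X) := by
  have hg : Measurable fun p : ℝ × E => (condDistrib Y X P p.2).real (Iic p.1) := by
    have ht : MeasurableSet {q : (ℝ × E) × ℝ | q.2 ≤ q.1.1} :=
      measurableSet_le measurable_snd (measurable_fst.comp measurable_fst)
    exact (Kernel.measurable_kernel_prodMk_left
      (κ := (condDistrib Y X P).comap Prod.snd measurable_snd) ht).ennreal_toReal
  rw [← MeasurableSpace.comap_prodMk]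
  exact hg.comp (comap_measurable _)

theorem measurable_condTransform' (hX : Measurable X) (hY : Measurable Y) :
    Measurable (condTransform P Y X) :=
  measurable_condTransform.mono (sup_le hY.comap_le hX.comap_le) le_rfl

theorem stdUniform_Iic {r : ℝ} (h1 : r ≤ 1) : stdUniform (Iic r) = ENNReal.ofReal r := by
  rw [stdUniform, Measure.restrict_apply measurableSet_Iic]
  have : Iic r ∩ Icc 0 1 = Icc 0 r := by
    ext x; simp only [mem_inter_iff, mem_Iic, mem_Icc]
    exact ⟨fun h => ⟨h.2.1, h.1⟩, fun h => ⟨h.2, h.1, h.2.trans h1⟩⟩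
  rw [this, Real.volume_Icc, sub_zero]

instance : IsProbabilityMeasure stdUniform := ⟨by simp [stdUniform]⟩

/-- Monotonicity of the conditional distribution function `F(· | X)` gives one inclusion. As the
transform is uniform and independent of `X`, the larger event has probability `E[F(y | X)] = P(Y ≤
y)`, so the difference is null. No quantile function is needed. -/
theorem preimage_Iic_ae_eq_condTransform_le (hX : Measurable X) (hY : Measurable Y)
    (hlaw : P.map (condTransform P Y X) = stdUniform) (hind : IndepFun (condTransform P Y X) X P)
    (y : ℝ) : (Y ⁻¹' Iic y : Set Ω) =ᵐ[P]
      {ω | condTransform P Y X ω ≤ (condDistrib Y X P (X ω)).real (Iic y)} := by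
  have hV : Measurable (condTransform P Y X) := measurable_condTransform' hX hY
  have hF : Measurable fun x => (condDistrib Y X P x).real (Iic y) :=
    (Kernel.measurable_coe _ measurableSet_Iic).ennreal_toReal
  refine ae_eq_of_subset_of_measure_ge (fun ω hω => ?_) ?_
    (hY measurableSet_Iic).nullMeasurableSet (measure_ne_top _ _)
  · exact measureReal_mono (Iic_subset_Iic.2 hω)
  · have h1 := setLIntegral_condDistrib_of_measurableSet (μ := P) hX hY.aemeasurable
      (measurableSet_Iic (a := y)) (t := univ) MeasurableSet.univ
    rw [univ_inter, setLIntegral_univ] at h1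
    have hjoint := (indepFun_iff_map_prod_eq_prod_map_map hX.aemeasurable hV.aemeasurable).1
      hind.symm
    have hset : MeasurableSet {q : E × ℝ | q.2 ≤ (condDistrib Y X P q.1).real (Iic y)} :=
      measurableSet_le measurable_snd (hF.comp measurable_fst)
    have h2 : P {ω | condTransform P Y X ω ≤ (condDistrib Y X P (X ω)).real (Iic y)} =
        P.map (fun ω => (X ω, condTransform P Y X ω))
          {q : E × ℝ | q.2 ≤ (condDistrib Y X P q.1).real (Iic y)} := by
      rw [Measure.map_apply (hX.prodMk hV) hset]
      rfl
    rw [h2, hjoint, hlaw, Measure.prod_apply hset,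
      lintegral_map (measurable_measure_prodMk_left hset) hX, ← h1]
    refine lintegral_mono fun ω => ?_
    change stdUniform (Iic ((condDistrib Y X P (X ω)).real (Iic y))) ≤ _
    rw [stdUniform_Iic measureReal_le_one, ofReal_measureReal]

theorem comap_le_eventuallyMeasurableSpace (hX : Measurable X) (hY : Measurable Y)
    (hlaw : P.map (condTransform P Y X) = stdUniform) (hind : IndepFun (condTransform P Y X) X P) :
    MeasurableSpace.comap Y inferInstance ≤
      eventuallyMeasurableSpace (MeasurableSpace.comap (condTransform P Y X) inferInstance ⊔
        MeasurableSpace.comap X mE) (ae P) := by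
  have hb : (inferInstance : MeasurableSpace ℝ) = MeasurableSpace.generateFrom (range Iic) := by
    rw [← borel_eq_generateFrom_Iic]; exact BorelSpace.measurable_eq
  have hY' : MeasurableSpace.comap Y inferInstance =
      MeasurableSpace.generateFrom (preimage Y '' range Iic) := by
    rw [hb, MeasurableSpace.comap_generateFrom]
  rw [hY']
  refine MeasurableSpace.generateFrom_le ?_
  rintro _ ⟨_, ⟨y, rfl⟩, rfl⟩
  refine ⟨_, ?_, preimage_Iic_ae_eq_condTransform_le hX hY hlaw hind y⟩
  have hF : Measurable fun x => (condDistrib Y X P x).real (Iic y) :=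
    (Kernel.measurable_coe _ measurableSet_Iic).ennreal_toReal
  rw [← MeasurableSpace.comap_prodMk]
  exact ⟨{q : ℝ × E | q.1 ≤ (condDistrib Y X P q.2).real (Iic y)},
    measurableSet_le measurable_fst (hF.comp measurable_snd), rfl⟩

/-- The hypotheses make `V`, `W`, `X` mutually independent; the product law is swapped and
reassociated. -/
theorem indepFun_prodMk_right {V W : Ω → ℝ} (hV : Measurable V) (hW : Measurable W)
    (hX : Measurable X) (hVW : IndepFun V W P) (hX' : IndepFun (fun ω => (V ω, W ω)) X P) :
    IndepFun W (fun ω => (V ω, X ω)) P := by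
  have hVX : IndepFun V X P := hX'.comp measurable_fst measurable_id
  rw [indepFun_iff_map_prod_eq_prod_map_map hW.aemeasurable (hV.prodMk hX).aemeasurable,
    (indepFun_iff_map_prod_eq_prod_map_map hV.aemeasurable hX.aemeasurable).1 hVX]
  have h1 := (indepFun_iff_map_prod_eq_prod_map_map (hV.prodMk hW).aemeasurable
    hX.aemeasurable).1 hX'
  rw [(indepFun_iff_map_prod_eq_prod_map_map hV.aemeasurable hW.aemeasurable).1 hVW] at h1
  have hmp := (measurePreserving_prodAssoc (P.map W) (P.map V) (P.map X)).comp
    ((Measure.measurePreserving_swap (μ := P.map V) (ν := P.map W)).prod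
      (MeasurePreserving.id (P.map X)))
  rw [← hmp.map_eq, ← h1, Measure.map_map hmp.measurable ((hV.prodMk hW).prodMk hX)]
  rfl

/-- Given `X`, each variable and its transform carry the same information up to null sets. As the
pair of transforms is independent of `X`, conditioning on `X` does not affect their dependence. -/
theorem isCondIndep_iff_map_condTransform (hX : Measurable X) (hY : Measurable Y)
    (hZ : Measurable Z) (hlY : P.map (condTransform P Y X) = stdUniform)
    (hlZ : P.map (condTransform P Z X) = stdUniform)
    (hind : IndepFun (fun ω => (condTransform P Y X ω, condTransform P Z X ω)) X P) :
    IsCondIndep P (MeasurableSpace.comap Y inferInstance) (MeasurableSpace.comap Z inferInstance)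
        (MeasurableSpace.comap X mE) ↔
      IndepFun (condTransform P Y X) (condTransform P Z X) P := by
  have hV : Measurable (condTransform P Y X) := measurable_condTransform' hX hY
  have hW : Measurable (condTransform P Z X) := measurable_condTransform' hX hZ
  have hVX : IndepFun (condTransform P Y X) X P := hind.comp measurable_fst measurable_id
  have hWX : IndepFun (condTransform P Z X) X P := hind.comp measurable_snd measurable_id
  constructor
  · intro h
    have h1 := h.sup_sup hY.comap_le hZ.comap_le hX.comap_le
    have h2 := (h1.mono_right (measurable_condTransform (P := P) (Y := Z) (X := X)).comap_le).mono_left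
      (sup_le hY.comap_le hX.comap_le) hX.comap_le
      (measurable_condTransform (P := P) (Y := Y) (X := X)).comap_le
    rw [indepFun_iff_measure_inter_preimage_eq_mul]
    intro s t hs ht
    have hsm : MeasurableSet (condTransform P Y X ⁻¹' s) := hV hs
    have htm : MeasurableSet (condTransform P Z X ⁻¹' t) := hW ht
    have hti : Integrable ((condTransform P Z X ⁻¹' t).indicator fun _ => (1 : ℝ)) P :=
      (integrable_const 1).indicator htm
    have h3 := h2 _ ⟨t, ht, rfl⟩
    have h4 : P⟦condTransform P Z X ⁻¹' t | MeasurableSpace.comap X mE⟧ =ᵐ[P]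
        fun _ => P[(condTransform P Z X ⁻¹' t).indicator fun _ => (1 : ℝ)] :=
      condExp_indep_eq hW.comap_le hX.comap_le
        (stronglyMeasurable_const.indicator ⟨t, ht, rfl⟩) hWX
    have h5 : ∫ ω in condTransform P Y X ⁻¹' s,
        (condTransform P Z X ⁻¹' t).indicator (fun _ => (1 : ℝ)) ω ∂P =
        ∫ _ in condTransform P Y X ⁻¹' s,
          P[(condTransform P Z X ⁻¹' t).indicator fun _ => (1 : ℝ)] ∂P := by
      rw [← setIntegral_condExp (sup_le hV.comap_le hX.comap_le) hti
        (le_sup_left (a := MeasurableSpace.comap (condTransform P Y X) inferInstance)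
          (b := MeasurableSpace.comap X mE) _ ⟨s, hs, rfl⟩)]
      refine setIntegral_congr_ae hsm ?_
      filter_upwards [h3, h4] with ω h3 h4 _ using h3.trans h4
    rw [setIntegral_indicator htm, setIntegral_const, setIntegral_const, smul_eq_mul, mul_one,
      integral_indicator htm, setIntegral_const, smul_eq_mul, smul_eq_mul, mul_one] at h5
    rw [← ENNReal.toReal_eq_toReal_iff' (measure_ne_top _ _) (by finiteness), ENNReal.toReal_mul]
    exact h5
  · intro h
    have h1 : IsCondIndep P (MeasurableSpace.comap (condTransform P Y X) inferInstance)
        (MeasurableSpace.comap (condTransform P Z X) inferInstance)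
        (MeasurableSpace.comap X mE) := by
      intro t ht
      have hsm : StronglyMeasurable[MeasurableSpace.comap (condTransform P Z X) inferInstance]
          (t.indicator fun _ => (1 : ℝ)) := stronglyMeasurable_const.indicator ht
      have hind' := indepFun_prodMk_right hV hW hX h hind
      have hind'' : Indep (MeasurableSpace.comap (condTransform P Z X) inferInstance)
          (MeasurableSpace.comap (condTransform P Y X) inferInstance ⊔
            MeasurableSpace.comap X mE) P := by
        rw [← MeasurableSpace.comap_prodMk]
        exact hind'
      exact (condExp_indep_eq hW.comap_le (sup_le hV.comap_le hX.comap_le) hsm hind'').trans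
        (condExp_indep_eq hW.comap_le hX.comap_le hsm hWX).symm
    have h2 := h1.sup_sup hV.comap_le hW.comap_le hX.comap_le
    have h3 := h2.eventually_right (comap_le_eventuallyMeasurableSpace hX hZ hlZ hWX)
    have h4 := (h3.symm (sup_le hV.comap_le hX.comap_le) hZ.comap_le hX.comap_le).eventually_right
      (comap_le_eventuallyMeasurableSpace hX hY hlY hVX)
    exact h4.symm hZ.comap_le hY.comap_le hX.comap_le

end CondTransform

/-! ### Independence copulas -/

theorem pairMeasure_eq_prod_iff {c : ℝ × ℝ → ℝ≥0} (hc : Measurable c) :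
    pairMeasure c = stdUniform.prod stdUniform ↔ IsIndepCopula c := by
  have h1 : stdUniform.prod stdUniform =
      (volume.restrict (Icc (0 : ℝ) 1 ×ˢ Icc (0 : ℝ) 1)).withDensity (fun _ => (1 : ℝ≥0∞)) := by
    rw [stdUniform, Measure.prod_restrict, ← Measure.volume_eq_prod]
    exact withDensity_one.symm
  rw [h1, pairMeasure, withDensity_eq_iff_of_sigmaFinite hc.coe_nnreal_ennreal.aemeasurable
    aemeasurable_const, IsIndepCopula]
  refine ⟨fun h => ?_, fun h => ?_⟩ <;> filter_upwards [h] with x hx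
  · exact_mod_cast hx
  · simp [hx]

theorem isIndepCopula_iff_isCondIndep {ι : Type} {Ω : Type*} [MeasurableSpace Ω] {P : Measure Ω}
    [IsProbabilityMeasure P] {U : ι → Ω → ℝ} {a b : ι} {D : Finset ι} (ha : Measurable (U a))
    (hb : Measurable (U b)) (hD : ∀ i ∈ D, Measurable (U i)) {c : ℝ × ℝ → ℝ≥0}
    (hc : IsCopulaDensity c)
    (hlaw : HasLaw (fun ω => (condPIT P U a D ω, condPIT P U b D ω)) (pairMeasure c) P)
    (hind : IndepFun (fun ω => (condPIT P U a D ω, condPIT P U b D ω)) (subvec U D) P) :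
    IsIndepCopula c ↔ IsCondIndep P (sigmaOf U {a}) (sigmaOf U {b}) (sigmaOf U D) := by
  have hX : Measurable (subvec U D) := measurable_pi_lambda _ fun i => hD i i.2
  have hV : Measurable (condPIT P U a D) := measurable_condTransform' hX ha
  have hW : Measurable (condPIT P U b D) := measurable_condTransform' hX hb
  have hlV : P.map (condPIT P U a D) = stdUniform := by
    rw [← hc.fst, ← hlaw.map_eq, Measure.map_map measurable_fst (hV.prodMk hW)]; rfl
  have hlW : P.map (condPIT P U b D) = stdUniform := by
    rw [← hc.snd, ← hlaw.map_eq, Measure.map_map measurable_snd (hV.prodMk hW)]; rfl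
  rw [sigmaOf_singleton, sigmaOf_singleton, ← comap_subvec U D,
    isCondIndep_iff_map_condTransform hX ha hb hlV hlW hind, ← pairMeasure_eq_prod_iff hc.measurable,
    ← hlaw.map_eq]
  change _ ↔ IndepFun (condPIT P U a D) (condPIT P U b D) P
  rw [indepFun_iff_map_prod_eq_prod_map_map hV.aemeasurable hW.aemeasurable, hlV, hlW]

/-! ### Conditional independence of subvectors -/

section Subvectors

variable {ι : Type} {Ω : Type*} {mΩ : MeasurableSpace Ω} {P : Measure Ω}
  {U : ι → Ω → ℝ} {S A A' B B' D : Finset ι}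

/-- `U_A` and `U_B` are conditionally independent given `U_D`. -/
def CondIndepSubvec (P : Measure Ω) (U : ι → Ω → ℝ) (A B D : Finset ι) : Prop :=
  IsCondIndep P (sigmaOf U A) (sigmaOf U B) (sigmaOf U D)

theorem condIndepSubvec_empty_left : CondIndepSubvec P U ∅ B D := by
  intro t _
  have h : sigmaOf U ∅ = ⊥ := by simp [sigmaOf]
  rw [h, bot_sup_eq]

variable [IsFiniteMeasure P]

theorem CondIndepSubvec.symm (hU : ∀ i ∈ S, Measurable (U i)) (hA : A ⊆ S) (hB : B ⊆ S)
    (hD : D ⊆ S) (h : CondIndepSubvec P U A B D) : CondIndepSubvec P U B A D :=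
  IsCondIndep.symm h (sigmaOf_le hU hA) (sigmaOf_le hU hB) (sigmaOf_le hU hD)

theorem condIndepSubvec_union_left_iff [DecidableEq ι] (hU : ∀ i ∈ S, Measurable (U i)) (hA : A ⊆ S)
    (hA' : A' ⊆ S) (hD : D ⊆ S) : CondIndepSubvec P U (A ∪ A') B D ↔
      CondIndepSubvec P U A' B D ∧ CondIndepSubvec P U A B (A' ∪ D) := by
  unfold CondIndepSubvec
  rw [sigmaOf_union, sigmaOf_union, isCondIndep_sup_left_iff (sigmaOf_le hU hA)
    (sigmaOf_le hU hA') (sigmaOf_le hU hD)]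

theorem condIndepSubvec_union_right_iff [DecidableEq ι] (hU : ∀ i ∈ S, Measurable (U i)) (hA : A ⊆ S)
    (hB : B ⊆ S) (hB' : B' ⊆ S) (hD : D ⊆ S) : CondIndepSubvec P U A (B ∪ B') D ↔
      CondIndepSubvec P U A B' D ∧ CondIndepSubvec P U A B (B' ∪ D) := by
  have hBB := Finset.union_subset hB hB'
  have hBD := Finset.union_subset hB' hD
  constructor
  · intro h
    have h' := (condIndepSubvec_union_left_iff hU hB hB' hD).1 (h.symm hU hA hBB hD)
    exact ⟨h'.1.symm hU hB' hA hD, h'.2.symm hU hB hA hBD⟩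
  · rintro ⟨h, h'⟩
    exact ((condIndepSubvec_union_left_iff hU hB hB' hD).2
      ⟨h.symm hU hA hB' hD, h'.symm hU hA hB hBD⟩).symm hU hBB hA hD

theorem CondIndepSubvec.mono (hU : ∀ i ∈ S, Measurable (U i)) (hA : A ⊆ S) (hD : D ⊆ S)
    (hAA : A' ⊆ A) (hBB : B' ⊆ B) (h : CondIndepSubvec P U A B D) : CondIndepSubvec P U A' B' D :=
  (IsCondIndep.mono_right h (sigmaOf_mono U hBB)).mono_left (sigmaOf_le hU hA) (sigmaOf_le hU hD)
    (sigmaOf_mono U hAA)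

end Subvectors

/-! ### Separation in vine copula models -/

namespace GraphSeq

variable {ι : Type} [DecidableEq ι] {Ω : Type*} [MeasurableSpace Ω] {P : Measure Ω}
  [IsProbabilityMeasure P] {G : GraphSeq ι} {C : PairCopulas G} {U : ι → Ω → ℝ} {A M B : Finset ι}

/-- The order of the conditioned pair chosen by `C` may be opposite to `(a, b)`; symmetry of
conditional independence absorbs this. -/
theorem JoinsAcross.isIndepCopula_iff (hG : G.IsVine) (hU : IsVineCopulaModel P U G C)
    {k : ℕ} {e : Sym2 (VineNode ι k)} {v w : VineNode ι k} {a b : ι}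
    (h : JoinsAcross A M B k e v w a b) (he : e ∈ G.E k) :
    IsIndepCopula (C.c k e) ↔ CondIndepSubvec P U {a} {b} (condSet k e) := by
  have hS : completeUnion (k + 1) e ⊆ G.S := completeUnion_subset hG (k := k + 1) he
  rw [h.completeUnion_eq] at hS
  have ha : a ∈ G.S := hS (by simp)
  have hb : b ∈ G.S := hS (by simp)
  have hD : condSet k e ⊆ G.S := fun x hx => hS (by simp [hx])
  have hpair := C.isConditioned k e he
  have hCa : C.a k e ∈ G.S ∧ C.b k e ∈ G.S := by
    rcases hpair.eq_or_eq h.isConditioned with ⟨h1, h2⟩ | ⟨h1, h2⟩ <;> rw [h1, h2]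
    exacts [⟨ha, hb⟩, ⟨hb, ha⟩]
  rw [isIndepCopula_iff_isCondIndep (hU.measurable _ hCa.1) (hU.measurable _ hCa.2)
    (fun i hi => hU.measurable i (hD hi)) (C.isCopulaDensity k e he) (hU.law_pair k e he)
    (hU.indep_pair k e he)]
  change CondIndepSubvec P U {C.a k e} {C.b k e} (condSet k e) ↔ _
  rcases hpair.eq_or_eq h.isConditioned with ⟨h1, h2⟩ | ⟨h1, h2⟩
  · rw [h1, h2]
  · rw [h1, h2]
    have ha' : {a} ⊆ G.S := Finset.singleton_subset_iff.2 ha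
    have hb' : {b} ⊆ G.S := Finset.singleton_subset_iff.2 hb
    exact ⟨fun h => h.symm hU.measurable hb' ha' hD, fun h => h.symm hU.measurable ha' hb' hD⟩

/-- Bracketed in the order in which the chain rule moves first the `A` part, then the `B` part, into
the conditioning set. -/
theorem JoinsAcross.condSet_eq {k : ℕ} {e : Sym2 (VineNode ι k)} {v w : VineNode ι k} {a b : ι}
    (h : JoinsAcross A M B k e v w a b) (hN : completeUnion (k + 1) e ⊆ A ∪ M ∪ B) :
    condSet k e = (condSet k e ∩ B) ∪ ((condSet k e ∩ A) ∪ M) := by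
  have hU := h.completeUnion_eq
  obtain ⟨-, -, -, -, -, -, -, hM⟩ := h
  ext x
  have h1 := @hN x
  have h2 := @hM x
  rw [hU] at h1
  simp only [Finset.mem_insert, Finset.mem_union, Finset.mem_inter] at *
  tauto

/-- Write `D_A = D ∩ A` and `D_B = D ∩ B`. The endpoints give `{a} ∪ D_A ⊥ D_B | M` and `D_A ⊥ {b} ∪
D_B | M`, the pair-copula gives `a ⊥ b | D`, and contraction combines the three. -/
theorem Separates.condIndepSubvec_node (h : G.Separates A M B) (hU : IsVineCopulaModel P U G C)
    (hind : ∀ k, ∀ e ∈ G.E k, Crosses A M B (completeUnion (k + 1) e) → IsIndepCopula (C.c k e))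
    {k : ℕ} {v : VineNode ι k} (hv : v ∈ G.V k) (hN : completeUnion k v ⊆ A ∪ M ∪ B) :
    CondIndepSubvec P U (completeUnion k v ∩ A) (completeUnion k v ∩ B) M := by
  have hM : M ⊆ G.S := fun x hx => h.subset (by simp [hx])
  have hA : A ⊆ G.S := fun x hx => h.subset (by simp [hx])
  have hB : B ⊆ G.S := fun x hx => h.subset (by simp [hx])
  have hm := hU.measurable
  rcases Finset.eq_empty_or_nonempty (completeUnion k v ∩ A) with hvA | ⟨x, hx⟩
  · rw [hvA]; exact condIndepSubvec_empty_left
  rcases Finset.eq_empty_or_nonempty (completeUnion k v ∩ B) with hvB | ⟨y, hy⟩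
  · rw [hvB]
    exact condIndepSubvec_empty_left.symm hm (Finset.empty_subset _)
      (Finset.inter_subset_right.trans hA) hM
  have hcr : Crosses A M B (completeUnion k v) :=
    (crosses_iff h.disjoint_left h.disjoint_right h.disjoint).2
      ⟨hN, ⟨x, Finset.mem_inter.1 hx⟩, y, Finset.mem_inter.1 hy⟩
  induction k generalizing x y with
  | zero =>
    rw [Finset.mem_inter] at hx hy
    have hxv : x = (v : ι) := Finset.mem_singleton.1 hx.1
    have hyv : y = (v : ι) := Finset.mem_singleton.1 hy.1
    have hxy : x = y := hxv.trans hyv.symm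
    exact absurd (hxy ▸ hy.2) (Finset.disjoint_left.1 h.disjoint hx.2)
  | succ k ih =>
    -- Endpoints of a crossing edge need not cross; for those that do not, one side is empty and the
    -- claim is trivial.
    have ih' : ∀ u ∈ G.V k, completeUnion k u ⊆ A ∪ M ∪ B →
        CondIndepSubvec P U (completeUnion k u ∩ A) (completeUnion k u ∩ B) M := by
      intro u hu huN
      rcases Finset.eq_empty_or_nonempty (completeUnion k u ∩ A) with hvA | ⟨x, hx⟩
      · rw [hvA]; exact condIndepSubvec_empty_left
      rcases Finset.eq_empty_or_nonempty (completeUnion k u ∩ B) with hvB | ⟨y, hy⟩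
      · rw [hvB]
        exact condIndepSubvec_empty_left.symm hm (Finset.empty_subset _)
          (Finset.inter_subset_right.trans hA) hM
      exact ih hu huN x hx y hy ((crosses_iff h.disjoint_left h.disjoint_right h.disjoint).2
        ⟨huN, ⟨x, Finset.mem_inter.1 hx⟩, y, Finset.mem_inter.1 hy⟩)
    obtain ⟨v₁, v₂, a, b, hJ⟩ := h.joinsAcross hv hcr
    have hc := (hJ.isIndepCopula_iff h.isVine hU hv).1 (hind k v hv hcr)
    rw [hJ.condSet_eq hN] at hc
    have hVU := hJ.completeUnion_eq
    obtain ⟨he, haA, hbB, -, -, hv₁, hv₂, -⟩ := hJ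
    have haB := Finset.disjoint_left.1 h.disjoint haA
    have hbA := Finset.disjoint_right.1 h.disjoint hbB
    have hmem := (h.isVine.edge_mem k _ hv).2
    have h₁ := ih' v₁ (hmem v₁ (by rw [he]; exact Sym2.mem_mk_left _ _))
      (by rw [hv₁]; rw [hVU] at hN; exact fun z hz => hN (by grind))
    have h₂ := ih' v₂ (hmem v₂ (by rw [he]; exact Sym2.mem_mk_right _ _))
      (by rw [hv₂]; rw [hVU] at hN; exact fun z hz => hN (by grind))
    rw [hv₁, Finset.insert_inter_of_mem haA, Finset.insert_inter_of_notMem haB,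
      Finset.insert_eq] at h₁
    rw [hv₂, Finset.insert_inter_of_mem hbB, Finset.insert_inter_of_notMem hbA,
      Finset.insert_eq] at h₂
    rw [hVU, Finset.insert_inter_of_mem haA, Finset.insert_inter_of_notMem hbA,
      Finset.insert_inter_of_notMem haB, Finset.insert_inter_of_mem hbB, Finset.insert_eq,
      Finset.insert_eq]
    have ha' : {a} ⊆ G.S := Finset.singleton_subset_iff.2 (hA haA)
    have hb' : {b} ⊆ G.S := Finset.singleton_subset_iff.2 (hB hbB)
    have hDA : condSet k v ∩ A ⊆ G.S := Finset.inter_subset_right.trans hA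
    have hDB : condSet k v ∩ B ⊆ G.S := Finset.inter_subset_right.trans hB
    refine (condIndepSubvec_union_left_iff hm ha' hDA hM).2 ⟨h₂, ?_⟩
    exact (condIndepSubvec_union_right_iff hm ha' hb' hDB (Finset.union_subset hDA hM)).2
      ⟨((condIndepSubvec_union_left_iff hm ha' hDA hM).1 h₁).2, hc⟩

/-- `U_A` and `U_B` are conditionally independent given `U_M` if and only if the pair-copulas of
all edges that cross from `A` to `B` are independence copulas. -/
theorem Separates.condIndepSubvec_iff (h : G.Separates A M B) (hv : (G.restr (A ∪ M ∪ B)).IsVine)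
    (hU : IsVineCopulaModel P U G C) : CondIndepSubvec P U A B M ↔
      ∀ k, ∀ e ∈ G.E k, Crosses A M B (completeUnion (k + 1) e) → IsIndepCopula (C.c k e) := by
  have hM : M ⊆ G.S := fun x hx => h.subset (by simp [hx])
  have hA : A ⊆ G.S := fun x hx => h.subset (by simp [hx])
  have hB : B ⊆ G.S := fun x hx => h.subset (by simp [hx])
  have hm := hU.measurable
  constructor
  · intro hAB k e he hcr
    obtain ⟨v, w, a, b, hJ⟩ := h.joinsAcross he hcr
    rw [hJ.isIndepCopula_iff h.isVine hU he, hJ.condSet_eq hcr.1]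
    obtain ⟨-, haA, hbB, -⟩ := hJ
    have ha' : {a} ⊆ G.S := Finset.singleton_subset_iff.2 (hA haA)
    have hb' : {b} ⊆ G.S := Finset.singleton_subset_iff.2 (hB hbB)
    have hDA : condSet k e ∩ A ⊆ G.S := Finset.inter_subset_right.trans hA
    have hDB : condSet k e ∩ B ⊆ G.S := Finset.inter_subset_right.trans hB
    have h1 : CondIndepSubvec P U ({a} ∪ (condSet k e ∩ A)) ({b} ∪ (condSet k e ∩ B)) M :=
      hAB.mono hm hA hM
        (Finset.union_subset (Finset.singleton_subset_iff.2 haA) Finset.inter_subset_right)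
        (Finset.union_subset (Finset.singleton_subset_iff.2 hbB) Finset.inter_subset_right)
    have h2 := ((condIndepSubvec_union_left_iff hm ha' hDA hM).1 h1).2
    exact ((condIndepSubvec_union_right_iff hm ha' hb' hDB (Finset.union_subset hDA hM)).1 h2).2
  · intro hind
    rcases Finset.eq_empty_or_nonempty A with rfl | hAne
    · exact condIndepSubvec_empty_left
    have hpos : 0 < (A ∪ M ∪ B).card := by
      obtain ⟨x, hx⟩ := hAne
      exact Finset.card_pos.2 ⟨x, by simp [hx]⟩
    -- The top vertex of the vine on `A ∪ M ∪ B`: its complete union has as many elements as the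
    -- whole set, hence is all of it.
    obtain ⟨r, hr⟩ := hv.nonempty_V (k := (A ∪ M ∪ B).card - 1) (Nat.sub_lt hpos one_pos)
    rw [mem_restr_V_iff h.isVine h.subset] at hr
    have hcard := card_completeUnion h.isVine h.isConditioned hr.1
    have hrU : completeUnion _ r = A ∪ M ∪ B :=
      Finset.eq_of_subset_of_card_le hr.2 (by omega)
    have hnode := h.condIndepSubvec_node hU hind hr.1 hr.2
    rw [hrU] at hnode
    rwa [Finset.inter_eq_right.2 (show A ⊆ A ∪ M ∪ B from fun x hx => by simp [hx]),
      Finset.inter_eq_right.2 (show B ⊆ A ∪ M ∪ B from fun x hx => by simp [hx])] at hnode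

end GraphSeq

/-! ### Time blocks -/

section TimeBlocks

variable {d : ℕ}

theorem mem_timeBlock {s t : ℤ} {i : ℤ × Fin d} : i ∈ timeBlock d s t ↔ s ≤ i.1 ∧ i.1 ≤ t := by
  simp [timeBlock]

theorem timeBlock_union {r s t : ℤ} (h : r ≤ s + 1) (h' : s ≤ t) :
    timeBlock d r s ∪ timeBlock d (s + 1) t = timeBlock d r t := by
  ext i
  rw [Finset.mem_union, mem_timeBlock, mem_timeBlock, mem_timeBlock]
  omega

theorem timeBlock_subset {r s s' t : ℤ} (h : r ≤ s) (h' : s' ≤ t) :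
    timeBlock d s s' ⊆ timeBlock d r t := fun i hi => by
  rw [mem_timeBlock] at hi ⊢
  omega

theorem disjoint_timeBlock {r s s' t : ℤ} (h : s < s') :
    Disjoint (timeBlock d r s) (timeBlock d s' t) :=
  Finset.disjoint_left.2 fun i hi hi' => by
    rw [mem_timeBlock] at hi hi'
    omega

theorem GraphSeq.IsStationaryVine.isVine_restr {T : ℕ} {G : GraphSeq (ℤ × Fin d)}
    (hG : G.IsStationaryVine T) {s t : ℤ} (hs : 1 ≤ s) (hst : s ≤ t) (ht : t ≤ T) :
    (G.restr (timeBlock d s t)).IsVine := by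
  obtain ⟨-, -, W, hW⟩ := hG
  have h := ((hW (t - s).toNat (by omega)).2.2 s hs (by omega)).1
  have hs' : s + ((t - s).toNat : ℤ) = t := by omega
  rw [hs'] at h
  exact h

theorem GraphSeq.IsStationaryVine.separates {T : ℕ} {G : GraphSeq (ℤ × Fin d)}
    (hG : G.IsStationaryVine T) (hc : ∀ k, ∀ e ∈ G.E k, ∃ a b, IsConditioned k e a b)
    {s t : ℤ} (hs : 1 ≤ s) (hst : s < t) (ht : t ≤ T) :
    G.Separates (timeBlock d s s) (timeBlock d (s + 1) (t - 1)) (timeBlock d t t) where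
  isVine := hG.2.1
  isConditioned := hc
  subset := by
    rw [hG.1]
    exact Finset.union_subset (Finset.union_subset (timeBlock_subset hs (by omega))
      (timeBlock_subset (by omega) (by omega))) (timeBlock_subset (by omega) ht)
  disjoint_left := disjoint_timeBlock (by omega)
  disjoint_right := (disjoint_timeBlock (by omega)).symm
  disjoint := disjoint_timeBlock hst
  isVine_left := by
    rw [timeBlock_union (by omega) (by omega)]
    exact hG.isVine_restr hs (by omega) (by omega)
  isVine_right := by
    have h := timeBlock_union (d := d) (r := s + 1) (s := t - 1) (t := t) (by omega) (by omega)
    rw [sub_add_cancel] at h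
    rw [h]
    exact hG.isVine_restr (by omega) (by omega) (by omega)
  -- Stationarity speaks of nonempty time intervals; an element of the middle block guarantees `s +
  -- 1 ≤ t - 1`.
  isVine_mid := by
    rintro ⟨i, hi⟩
    rw [mem_timeBlock] at hi
    exact hG.isVine_restr (by omega) (by omega) (by omega)

theorem timeBlock_union_union {s t : ℤ} (h : s < t) :
    timeBlock d s s ∪ timeBlock d (s + 1) (t - 1) ∪ timeBlock d t t = timeBlock d s t := by
  ext i
  simp only [Finset.mem_union, mem_timeBlock]
  omega

theorem crosses_timeBlock_iff {s t : ℤ} (h : s < t) {N : Finset (ℤ × Fin d)} :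
    GraphSeq.Crosses (timeBlock d s s) (timeBlock d (s + 1) (t - 1)) (timeBlock d t t) N ↔
      N ⊆ timeBlock d s t ∧ (∃ i ∈ N, i.1 = s) ∧ ∃ i ∈ N, i.1 = t := by
  rw [GraphSeq.crosses_iff (disjoint_timeBlock (by omega)) (disjoint_timeBlock (by omega)).symm
    (disjoint_timeBlock h), timeBlock_union_union h]
  simp only [mem_timeBlock]
  have h1 : ∀ i : ℤ × Fin d, (s ≤ i.1 ∧ i.1 ≤ s) ↔ i.1 = s := fun i => by omega
  have h2 : ∀ i : ℤ × Fin d, (t ≤ i.1 ∧ i.1 ≤ t) ↔ i.1 = t := fun i => by omega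
  simp only [h1, h2]

end TimeBlocks

/-! ### The Markov property -/

section Markov

variable {d : ℕ} {Ω : Type*} {U : ℤ × Fin d → Ω → ℝ}

/-- The event that `U_t ≤ u`. -/
def lowerOrthant (U : ℤ × Fin d → Ω → ℝ) (t : ℤ) (u : Fin d → ℝ) : Set Ω :=
  {ω | ∀ j, U (t, j) ω ≤ u j}

theorem isPiSystem_lowerOrthant (t : ℤ) : IsPiSystem (range (lowerOrthant U t)) := by
  rintro _ ⟨u, rfl⟩ _ ⟨u', rfl⟩ -
  refine ⟨fun j => min (u j) (u' j), ?_⟩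
  ext ω
  simp only [lowerOrthant, mem_ofPred_eq, le_min_iff, mem_inter_iff, forall_and]

theorem sigmaOf_timeBlock_eq_generateFrom (t : ℤ) :
    sigmaOf U (timeBlock d t t) = MeasurableSpace.generateFrom (range (lowerOrthant U t)) := by
  apply le_antisymm
  · refine iSup₂_le ?_
    rintro ⟨t', j⟩ hi
    rw [mem_timeBlock] at hi
    obtain rfl : t' = t := le_antisymm hi.2 hi.1
    have hb : (inferInstance : MeasurableSpace ℝ) = MeasurableSpace.generateFrom (range Iic) := by
      rw [← borel_eq_generateFrom_Iic]; exact BorelSpace.measurable_eq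
    rw [hb, MeasurableSpace.comap_generateFrom]
    refine MeasurableSpace.generateFrom_le ?_
    rintro _ ⟨_, ⟨y, rfl⟩, rfl⟩
    -- A constraint on one coordinate is a countable union of orthants, the other bounds being `n →
    -- ∞`.
    have h : U (t', j) ⁻¹' Iic y =
        ⋃ n : ℕ, lowerOrthant U t' (Function.update (fun _ => (n : ℝ)) j y) := by
      ext ω
      simp only [mem_preimage, mem_Iic, mem_iUnion, lowerOrthant, mem_ofPred_eq]
      constructor
      · intro hω
        obtain ⟨r, hr⟩ := (Set.finite_range fun j => U (t', j) ω).bddAbove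
        obtain ⟨n, hn⟩ := exists_nat_ge r
        refine ⟨n, fun i => ?_⟩
        rcases eq_or_ne i j with rfl | hij
        · simpa using hω
        · rw [Function.update_of_ne hij]
          exact (hr ⟨i, rfl⟩).trans hn
      · rintro ⟨n, hn⟩
        simpa using hn j
    rw [h]
    exact MeasurableSet.iUnion fun n => MeasurableSpace.measurableSet_generateFrom ⟨_, rfl⟩
  · refine MeasurableSpace.generateFrom_le ?_
    rintro _ ⟨u, rfl⟩
    have h : lowerOrthant U t u = ⋂ j, U (t, j) ⁻¹' Iic (u j) := by
      ext ω; simp [lowerOrthant]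
    rw [h]
    refine MeasurableSet.iInter fun j => ?_
    have hle : MeasurableSpace.comap (U (t, j)) inferInstance ≤ sigmaOf U (timeBlock d t t) :=
      le_iSup₂ (f := fun i (_ : i ∈ timeBlock d t t) =>
        MeasurableSpace.comap (U i) (inferInstance : MeasurableSpace ℝ)) (t, j)
        (mem_timeBlock.2 ⟨le_rfl, le_rfl⟩)
    exact hle _ ⟨Iic (u j), measurableSet_Iic, rfl⟩

variable [MeasurableSpace Ω] {P : Measure Ω} [IsFiniteMeasure P]

theorem isMarkovOfOrder_iff {T p : ℕ} (hU : ∀ i ∈ timeBlock d 1 T, Measurable (U i)) :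
    IsMarkovOfOrder P U T p ↔ ∀ t : ℤ, p < t → t ≤ T →
      CondIndepSubvec P U (timeBlock d 1 (t - p - 1)) (timeBlock d t t)
        (timeBlock d (t - p) (t - 1)) := by
  refine forall_congr' fun t => forall_congr' fun hpt => forall_congr' fun htT => ?_
  have hA : timeBlock d 1 (t - p - 1) ⊆ timeBlock d 1 T := timeBlock_subset le_rfl (by omega)
  have hB : timeBlock d t t ⊆ timeBlock d 1 T := timeBlock_subset (by omega) htT
  have hD : timeBlock d (t - p) (t - 1) ⊆ timeBlock d 1 T :=
    timeBlock_subset (by omega) (by omega)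
  have hunion : sigmaTimes U 1 (t - 1) =
      sigmaOf U (timeBlock d 1 (t - p - 1)) ⊔ sigmaOf U (timeBlock d (t - p) (t - 1)) := by
    have h := timeBlock_union (d := d) (r := 1) (s := t - p - 1) (t := t - 1) (by omega) (by omega)
    rw [sub_add_cancel] at h
    rw [← sigmaOf_union, h]
  rw [hunion]
  have hgen := sigmaOf_timeBlock_eq_generateFrom (U := U) t
  constructor
  · intro h
    refine (IsCondIndep.symm_of_generateFrom (sigmaOf_le hU hA) (sigmaOf_le hU hB)
      (sigmaOf_le hU hD) (isPiSystem_lowerOrthant t) hgen ?_).symm (sigmaOf_le hU hB)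
      (sigmaOf_le hU hA) (sigmaOf_le hU hD)
    rintro _ ⟨u, rfl⟩
    exact h u
  · intro h u
    refine h (lowerOrthant U t u) ?_
    rw [hgen]
    exact MeasurableSpace.measurableSet_generateFrom ⟨u, rfl⟩

/-- The chain rule splits off the earliest time point; the later ones join the conditioning block.
-/
theorem condIndepSubvec_timeBlock_iff {T : ℕ} (hU : ∀ i ∈ timeBlock d 1 T, Measurable (U i))
    {r t : ℤ} (hrt : r < t) (ht : t ≤ T) (n : ℕ) (hn : n ≤ r) :
    CondIndepSubvec P U (timeBlock d (r + 1 - n) r) (timeBlock d t t) (timeBlock d (r + 1) (t - 1)) ↔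
      ∀ s : ℤ, r + 1 - n ≤ s → s ≤ r →
        CondIndepSubvec P U (timeBlock d s s) (timeBlock d t t) (timeBlock d (s + 1) (t - 1)) := by
  induction n with
  | zero =>
    have h0 : timeBlock d (r + 1 - ((0 : ℕ) : ℤ)) r = ∅ := by
      ext i; simp only [mem_timeBlock, Finset.notMem_empty, iff_false]; omega
    rw [h0]
    exact ⟨fun _ s h h' => absurd h' (by omega), fun _ => condIndepSubvec_empty_left⟩
  | succ n ih =>
    have h1 := timeBlock_union (d := d) (r := r - n) (s := r - n) (t := r) (by omega) (by omega)
    have h2 := timeBlock_union (d := d) (r := r - n + 1) (s := r) (t := t - 1) (by omega) (by omega)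
    have h3 : r + 1 - ((n + 1 : ℕ) : ℤ) = r - n := by push_cast; ring
    have h4 : r + 1 - (n : ℤ) = r - n + 1 := by ring
    rw [h4] at ih
    rw [h3, ← h1, condIndepSubvec_union_left_iff hU (timeBlock_subset (by omega) (by omega))
      (timeBlock_subset (by omega) (by omega)) (timeBlock_subset (by omega) (by omega)), h2,
      ih (by omega)]
    constructor
    · rintro ⟨h, h'⟩ s hs hsr
      rcases eq_or_lt_of_le hs with rfl | hs
      · exact h'
      · exact h s (by omega) hsr
    · exact fun h => ⟨fun s hs hsr => h s (by omega) hsr, h _ le_rfl (by omega)⟩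

end Markov

/-! ### The characterization of the Markov order -/

theorem mainTheorem3 {Ω : Type*} [MeasurableSpace Ω] (P : Measure Ω) [IsProbabilityMeasure P]
    (T d p : ℕ) (hp : p < T)
    (G : GraphSeq (ℤ × Fin d)) (hG : G.IsStationaryVine T) (C : PairCopulas G)
    (U : ℤ × Fin d → Ω → ℝ) (hU : IsVineCopulaModel P U G C) :
    IsMarkovOfOrder P U T p ↔
      ∀ k, ∀ e ∈ G.E k,
        (∀ t : ℤ, 1 ≤ t → t + p ≤ T → e ∉ (G.restrict t (t + p)).E k) →
          IsIndepCopula (C.c k e) := by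
  have hc : ∀ k, ∀ e ∈ G.E k, ∃ a b, IsConditioned k e a b :=
    fun k e he => ⟨_, _, C.isConditioned k e he⟩
  have hm : ∀ i ∈ timeBlock d 1 T, Measurable (U i) := hG.1 ▸ hU.measurable
  have hpair : ∀ s t : ℤ, 1 ≤ s → s < t → t ≤ T →
      (CondIndepSubvec P U (timeBlock d s s) (timeBlock d t t) (timeBlock d (s + 1) (t - 1)) ↔
        ∀ k, ∀ e ∈ G.E k, completeUnion (k + 1) e ⊆ timeBlock d s t ∧
          (∃ i ∈ completeUnion (k + 1) e, i.1 = s) ∧ (∃ i ∈ completeUnion (k + 1) e, i.1 = t) →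
            IsIndepCopula (C.c k e)) := by
    intro s t hs hst ht
    rw [(hG.separates hc hs hst ht).condIndepSubvec_iff
      (by rw [timeBlock_union_union hst]; exact hG.isVine_restr hs hst.le ht) hU]
    simp only [crosses_timeBlock_iff hst]
  have hrestr : ∀ t : ℤ, 1 ≤ t → t + p ≤ T → ∀ k, ∀ e ∈ G.E k,
      (e ∈ (G.restrict t (t + p)).E k ↔ completeUnion (k + 1) e ⊆ timeBlock d t (t + p)) := by
    intro t ht htT k e he
    have h := GraphSeq.mem_restr_E_iff hG.2.1 (X := timeBlock d t (t + p))
      (by rw [hG.1]; exact timeBlock_subset ht htT) (e := e)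
    exact h.trans (and_iff_right he)
  rw [isMarkovOfOrder_iff hm]
  have hchain : ∀ t : ℤ, p < t → t ≤ T →
      (CondIndepSubvec P U (timeBlock d 1 (t - p - 1)) (timeBlock d t t)
        (timeBlock d (t - p) (t - 1)) ↔ ∀ s : ℤ, 1 ≤ s → s ≤ t - p - 1 →
        CondIndepSubvec P U (timeBlock d s s) (timeBlock d t t) (timeBlock d (s + 1) (t - 1))) := by
    intro t hpt htT
    have h := condIndepSubvec_timeBlock_iff (P := P) hm (r := t - p - 1) (t := t) (by omega) htT
      (t - p - 1).toNat (by omega)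
    have h1 : t - p - 1 + 1 - ((t - p - 1).toNat : ℤ) = 1 := by omega
    rwa [h1, sub_add_cancel] at h
  constructor
  · intro h k e he hnot
    have hS : completeUnion (k + 1) e ⊆ timeBlock d 1 T := by
      rw [← hG.1]; exact GraphSeq.completeUnion_subset hG.2.1 (k := k + 1) he
    have hne : (completeUnion (k + 1) e).Nonempty := by
      rw [← Finset.card_pos, GraphSeq.card_completeUnion hG.2.1 hc (k := k + 1) he]
      omega
    obtain ⟨i, hi, himin⟩ := Finset.exists_min_image _ Prod.fst hne
    obtain ⟨j, hj, hjmax⟩ := Finset.exists_max_image _ Prod.fst hne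
    have hi1 := mem_timeBlock.1 (hS hi)
    have hj1 := mem_timeBlock.1 (hS hj)
    by_cases hij : j.1 - i.1 ≤ p
    -- A time span of at most `p` fits into a window starting at its earliest time, or at the last
    -- admissible start `T - p` if that window would pass `T`.
    · refine absurd ((hrestr (min i.1 (T - p)) (by omega) (by omega) k e he).2 ?_)
        (hnot _ (by omega) (by omega))
      intro x hx
      have := himin x hx
      have := hjmax x hx
      have := mem_timeBlock.1 (hS hx)
      rw [mem_timeBlock]
      omega
    · refine (hpair i.1 j.1 hi1.1 (by omega) hj1.2).1
        ((hchain j.1 (by omega) hj1.2).1 (h j.1 (by omega) hj1.2) i.1 hi1.1 (by omega)) k e he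
        ⟨fun x hx => mem_timeBlock.2 ⟨himin x hx, hjmax x hx⟩, ⟨i, hi, rfl⟩, j, hj, rfl⟩
  · intro h t hpt htT
    rw [hchain t hpt htT]
    intro s hs hst
    rw [hpair s t hs (by omega) htT]
    rintro k e he ⟨-, ⟨i, hi, his⟩, j, hj, hjt⟩
    -- A window from `t'` to `t' + p` cannot contain both `s` and `t`, as `t - s > p`.
    refine h k e he fun t' ht' ht'T hmem => ?_
    have hsub := (hrestr t' ht' ht'T k e he).1 hmem
    have h1 := mem_timeBlock.1 (hsub hi)
    have h2 := mem_timeBlock.1 (hsub hj)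
    omega
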